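/- **Proposition 2.4.** Let $M$ be a smooth finite-dimensional manifold with a Riemannian metric $g$, and let $\pi$ be a Poisson tensor on $M$, i.e. a smooth bivector field such that $\{f,h\}=\pi(df,dh)$ satisfies the Jacobi identity on $C^\infty(M)$. Let $\pi_\#:T^*M\to TM$ be the anchor, $\beta(\pi_\#(\alpha))=\pi(\alpha,\beta)$, let $\#:T^*M\to TM$ be the isomorphism given by the metric, let $\langle\cdot,\cdot\rangle$ be the induced metric on covectors, and let $$[\alpha,\beta]_\pi=L_{\pi_\#(\alpha)}\beta-L_{\pi_\#(\beta)}\alpha-d(\pi(\alpha,\beta))$$ be the Koszul bracket of 1-forms. Let $\mathcal D$ be the metric contravariant connection of $(\pi,g)$, given by $$\begin{aligned}2\langle\mathcal D_\alpha\beta,\gamma\rangle={}&\pi_\#(\alpha).\langle\beta,\gamma\rangle+\pi_\#(\beta).\langle\alpha,\gamma\rangle-\pi_\#(\gamma).\langle\alpha,\beta\rangle\\&+\langle[\gamma,\alpha]_\pi,\beta\rangle+\langle[\gamma,\beta]_\pi,\alpha\rangle+\langle[\alpha,\beta]_\pi,\gamma\rangle.\end{aligned}$$ For $U\subset M$ open,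 let $Z^0(U)=\{f\in C^\infty(U):\pi_\#(df)=0\}$ be the space of Casimir functions on $U$ and let $Z^1(U)=\{\alpha\in\Omega^1(U):[\alpha,\beta]_\pi=0\ \text{for all}\ \beta\in\Omega^1(U)\}$ be the center of $(\Omega^1(U),[\cdot,\cdot]_\pi)$. For $\alpha\in\Omega^1(U)$, write $\mathcal D\alpha=0$ if $\mathcal D_\beta\alpha=0$ for all $\beta\in\Omega^1(U)$. A vector field $X$ on $U$ is a Poisson vector field if $L_X\pi=0$ on $U$. Then the following assertions are equivalent: 1. For every open set $U\subset M$ and every $f\in Z^0(U)$, $\mathcal D\,df=0$. 2. For every open set $U\subset M$ and every $\alpha\in Z^1(U)$, $\mathcal D\alpha=0$. 3. For every open set $U\subset M$ and every $f\in Z^0(U)$, the gradient $\nabla f=\#(df)$ is a Poisson vector field. 4. For every open set $U\subset M$ and every $\alpha\in Z^1(U)$, $\#(\alpha)$ is a Poisson vector field. 5. $\mathcal D$ is an $\mathcal F^{reg}$-connection: at every point $p$ of the open set where the rank of $\pi$ is locally constant, $\pi_\#(\alpha)(p)=0$ implies $(\mathcal D_\alpha\beta)(p)=0$ for all 1-forms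 $\beta$. -/

import Mathlib

open Bundle Topology
open scoped Manifold ContDiff

noncomputable section

namespace PoissonRiemann

/-! Throughout, `M` is a smooth manifold without boundary modelled on a finite-dimensional real
vector space `E`. Tensor fields on an open set `U ⊆ M` are represented by (not necessarily
continuous) sections over all of `M` which are smooth on `U`; only their values on `U` matter,
since all the operations below are local. -/

variable {E : Type*} [NormedAddCommGroup E] [NormedSpace ℝ E]
  {M : Type*} [TopologicalSpace M] [ChartedSpace E M]

variable (E M) in
/-- Vector fields on `M`, no regularity imposed. -/
abbrev VField := Π x : M, TangentSpace 𝓘(ℝ, E) x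

variable (E M) in
/-- Differential 1-forms on `M`, no regularity imposed. -/
abbrev Form := Π x : M, TangentSpace 𝓘(ℝ, E) x →L[ℝ] ℝ

variable [IsManifold 𝓘(ℝ, E) ∞ M]

/-- `α ∈ Ω¹(U)`: the 1-form `α` is smooth on `U`. -/
def SmoothForm (α : Form E M) (U : Set M) : Prop :=
  ContMDiffOn 𝓘(ℝ, E) (𝓘(ℝ, E).prod 𝓘(ℝ, E →L[ℝ] ℝ)) ∞
    (fun x ↦ TotalSpace.mk' (E →L[ℝ] ℝ) (E := fun x : M ↦ TangentSpace 𝓘(ℝ, E) x →L[ℝ] ℝ)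
      x (α x)) U

/-- The differential `df` of a function. -/
def diff (f : M → ℝ) : Form E M := fun x ↦ mvfderiv 𝓘(ℝ, E) f x

/-- The derivative `X(f)` of a function along a vector field. -/
def dirDeriv (X : VField E M) (f : M → ℝ) : M → ℝ := fun x ↦ mvfderiv 𝓘(ℝ, E) f x (X x)

/-- The function `α(X)`. -/
def pair (α : Form E M) (X : VField E M) : M → ℝ := fun x ↦ α x (X x)

/-! ### Poisson tensors -/

variable (E M) in
/-- A Poisson tensor on `M`. The bivector field `π` is encoded by its anchor map `π_# : T*M → TM`,
which determines it and is determined by it through `π(α, β) = β(π_#(α))`; a bundle map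
`T*M → TM` arises in this way from a bivector field iff it is skew-symmetric. The last field is the
Jacobi identity for the bracket `{f, h} = π(df, dh)` on `C^∞(M)`, i.e. `[π, π] = 0`. -/
structure PoissonTensor where
  /-- the anchor `π_#` on the cotangent space at `x` -/
  anchor (x : M) : (TangentSpace 𝓘(ℝ, E) x →L[ℝ] ℝ) →L[ℝ] TangentSpace 𝓘(ℝ, E) x
  skew (x : M) (α β : TangentSpace 𝓘(ℝ, E) x →L[ℝ] ℝ) : β (anchor x α) = - α (anchor x β)
  smooth : ContMDiff 𝓘(ℝ, E) (𝓘(ℝ, E).prod 𝓘(ℝ, (E →L[ℝ] ℝ) →L[ℝ] E)) ∞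
    (fun x ↦ TotalSpace.mk' ((E →L[ℝ] ℝ) →L[ℝ] E)
      (E := fun x : M ↦ (TangentSpace 𝓘(ℝ, E) x →L[ℝ] ℝ) →L[ℝ] TangentSpace 𝓘(ℝ, E) x)
      x (anchor x))
  jacobi (f h k : M → ℝ) (hf : ContMDiff 𝓘(ℝ, E) 𝓘(ℝ, ℝ) ∞ f)
    (hh : ContMDiff 𝓘(ℝ, E) 𝓘(ℝ, ℝ) ∞ h) (hk : ContMDiff 𝓘(ℝ, E) 𝓘(ℝ, ℝ) ∞ k) (x : M) :
    let br : (M → ℝ) → (M → ℝ) → M → ℝ := fun u v y ↦ diff v y (anchor y (diff u y))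
    br f (br h k) x + br h (br k f) x + br k (br f h) x = 0

namespace PoissonTensor

variable (P : PoissonTensor E M)

/-- The vector field `π_#(α)`. -/
def sharp (α : Form E M) : VField E M := fun x ↦ P.anchor x (α x)

/-- The function `π(α, β) = β(π_#(α))`. -/
def eval (α β : Form E M) : M → ℝ := pair β (P.sharp α)

/-- The set of points near which the rank of `π` is constant. -/
def regularSet : Set M :=
  {x | ∀ᶠ y in 𝓝 x, (P.anchor y).rank = (P.anchor x).rank}

/-- `f ∈ Z⁰(U)`: the function `f` is smooth on `U` and is a Casimir function there. -/
def IsCasimirOn (f : M → ℝ) (U : Set M) : Prop :=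
  ContMDiffOn 𝓘(ℝ, E) 𝓘(ℝ, ℝ) ∞ f U ∧ ∀ x ∈ U, P.sharp (diff f) x = 0

end PoissonTensor

variable [FiniteDimensional ℝ E]

open Classical in
/-- The covector `ω` at `x` determined by an operation `Φ` on vector fields which is tensorial at
`x`, that is, `ω (Y x) = Φ Y` for every vector field `Y` differentiable at `x`. (Junk value `0` if
`Φ` is not tensorial at `x`.) -/
def covectorOf (x : M) (Φ : VField E M → ℝ) : TangentSpace 𝓘(ℝ, E) x →L[ℝ] ℝ :=
  if h : TensorialAt 𝓘(ℝ, E) E Φ x then TensorialAt.mkHom Φ x h else 0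

/-- The Lie derivative of a 1-form: `(L_X β)(Y) = X(β(Y)) - β([X, Y])`. -/
def lieForm (X : VField E M) (β : Form E M) : Form E M := fun x ↦
  covectorOf x fun Y ↦
    dirDeriv X (pair β Y) x - β x (VectorField.mlieBracket 𝓘(ℝ, E) X Y x)

namespace PoissonTensor

variable (P : PoissonTensor E M)

/-- The Koszul bracket `[α, β]_π = L_{π_#(α)} β - L_{π_#(β)} α - d(π(α, β))`. -/
def koszul (α β : Form E M) : Form E M := fun x ↦
  lieForm (P.sharp α) β x - lieForm (P.sharp β) α x - diff (P.eval α β) x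

/-- `α ∈ Z¹(U)`: the 1-form `α` is in the center of the Lie algebra `(Ω¹(U), [ , ]_π)`. -/
def IsCentralOn (α : Form E M) (U : Set M) : Prop :=
  SmoothForm α U ∧ ∀ β : Form E M, SmoothForm β U → ∀ x ∈ U, P.koszul α β x = 0

/-- The Lie derivative of `π`: `(L_X π)(α, β) = X(π(α, β)) - π(L_X α, β) - π(α, L_X β)`. -/
def lieDeriv (X : VField E M) (α β : Form E M) : M → ℝ := fun x ↦
  dirDeriv X (P.eval α β) x - P.eval (lieForm X α) β x - P.eval α (lieForm X β) x

/-- The vector field `X` preserves `π` on `U`, i.e. `L_X π = 0` on `U`. -/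
def IsPoissonFieldOn (X : VField E M) (U : Set M) : Prop :=
  ∀ α β : Form E M, SmoothForm α U → SmoothForm β U → ∀ x ∈ U, P.lieDeriv X α β x = 0

/-- An operator `D : Ω¹ × Ω¹ → Ω¹` (in practice a contravariant connection on `T*M`) is an
`F`-connection on `U`: at each point of `U`, `π_#(α) = 0` implies `D_α = 0`. -/
def IsFConnectionOn (D : Form E M → Form E M → Form E M) (U : Set M) : Prop :=
  ∀ α β : Form E M, SmoothForm α U → SmoothForm β U → ∀ x ∈ U, P.sharp α x = 0 → D α β x = 0

/-- `D` is an `F^reg`-connection: it is an `F`-connection on the open set where the rank of `π` is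
locally constant. -/
def IsFRegConnection (D : Form E M → Form E M → Form E M) : Prop :=
  P.IsFConnectionOn D P.regularSet

end PoissonTensor

/-! ### Riemannian metrics -/

variable (E M) in
/-- Smooth Riemannian metrics on `M`. -/
abbrev Metric :=
  ContMDiffRiemannianMetric 𝓘(ℝ, E) ∞ E (fun x : M ↦ TangentSpace 𝓘(ℝ, E) x)

namespace Metric

variable (g : Metric E M)

theorem inner_bijective (x : M) : Function.Bijective (g.inner x) := by
  have : FiniteDimensional ℝ (TangentSpace 𝓘(ℝ, E) x) := inferInstanceAs (FiniteDimensional ℝ E)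
  have : T2Space (TangentSpace 𝓘(ℝ, E) x) := inferInstanceAs (T2Space E)
  have hinj : Function.Injective (g.inner x).toLinearMap := by
    refine (injective_iff_map_eq_zero _).2 fun v hv ↦ ?_
    by_contra hne
    have := g.pos x v hne
    have h0 : g.inner x v = 0 := hv
    simp [h0] at this
  let e : (TangentSpace 𝓘(ℝ, E) x →ₗ[ℝ] ℝ) ≃ₗ[ℝ] (TangentSpace 𝓘(ℝ, E) x →L[ℝ] ℝ) :=
    LinearMap.toContinuousLinearMap
  have : FiniteDimensional ℝ (TangentSpace 𝓘(ℝ, E) x →L[ℝ] ℝ) := e.finiteDimensional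
  have hr : Module.finrank ℝ (TangentSpace 𝓘(ℝ, E) x) =
      Module.finrank ℝ (TangentSpace 𝓘(ℝ, E) x →L[ℝ] ℝ) := by
    rw [← e.finrank_eq]
    exact Subspace.dual_finrank_eq.symm
  exact ⟨hinj, (LinearMap.injective_iff_surjective_of_finrank_eq_finrank hr).1 hinj⟩

/-- The 1-form `g(Y, ·)`. -/
def flat (Y : VField E M) : Form E M := fun x ↦ g.inner x (Y x)

/-- The isomorphism `# : T*M → TM` given by the metric: `g(#(α), ·) = α`. -/
def sharp (α : Form E M) : VField E M := fun x ↦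
  (LinearEquiv.ofBijective (g.inner x).toLinearMap (g.inner_bijective x)).symm (α x)

/-- The gradient `∇f = #(df)`. -/
def grad (f : M → ℝ) : VField E M := g.sharp (diff f)

/-- The function `⟨α, β⟩ = g(#(α), #(β))`, the metric on covectors. -/
def coInner (α β : Form E M) : M → ℝ := fun x ↦ g.inner x (g.sharp α x) (g.sharp β x)

/-- The metric contravariant connection associated with `(π, g)`, given by the Koszul formula
`2⟨D_α β, γ⟩ = π_#(α).⟨β, γ⟩ + π_#(β).⟨α, γ⟩ - π_#(γ).⟨α, β⟩
  + ⟨[γ, α]_π, β⟩ + ⟨[γ, β]_π, α⟩ + ⟨[α, β]_π, γ⟩`,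
where `γ = g(Y, ·)`, so that `⟨D_α β, γ⟩ = (D_α β)(Y)`. -/
def contravariantConnection (P : PoissonTensor E M) (α β : Form E M) : Form E M := fun x ↦
  covectorOf x fun Y ↦
    let γ := g.flat Y
    (1 / 2 : ℝ) *
      (dirDeriv (P.sharp α) (g.coInner β γ) x + dirDeriv (P.sharp β) (g.coInner α γ) x
        - dirDeriv (P.sharp γ) (g.coInner α β) x
        + g.coInner (P.koszul γ α) β x + g.coInner (P.koszul γ β) α x
        + g.coInner (P.koszul α β) γ x)

/-- `D α = 0` on `U`: for the metric contravariant connection `D`, `D_β α` vanishes on `U` for all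
`β ∈ Ω¹(U)`. -/
def IsParallelOn (P : PoissonTensor E M) (α : Form E M) (U : Set M) : Prop :=
  ∀ β : Form E M, SmoothForm β U → ∀ x ∈ U, g.contravariantConnection P β α x = 0

end Metric

end PoissonRiemann

end

/-! Everything rests on three properties of `D`. It is tensorial in its lower argument, it is
torsion-free (`D_α β - D_β α = [α, β]_π`), and for a central form `α` it satisfies `2⟨D_β α, γ⟩ =
-(L_{#(α)} π)(β, γ)`. The last identity makes `α` parallel exactly when `#(α)` is a Poisson field.
Differentials of Casimir functions are central, so 1 ↔ 3, 2 ↔ 4 and 2 → 1 follow at once.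

For 1 → 5, let `π_#(α)` vanish at a regular point. There `α` takes the value of `df` for some local
Casimir `f`, and tensoriality and torsion-freeness give `D_α β = D_{df} β = D_β df + [df, β]_π = 0`.
For 5 → 2, the Leibniz rule forces `π_#(α) = 0` for central `α`, so `D_β α = D_α β + [β, α]_π = 0`
at regular points. These are dense, because the rank is lower semicontinuous and bounded, and `D_β
α` is continuous, so it vanishes everywhere.

The analytic input is Frobenius' theorem for the range of the anchor near a regular point. The
distribution is written as the range of projections `B u` with a fixed kernel, which turns
involutivity into the symmetry of `DB(B v) w` in `v` and `w`. Following `c' = -B(c) Q(u - u₀)` from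
`c(0) = u` for unit time slides `u` along its leaf onto the slice `Q(u - u₀) = 0`; the endpoint, as
a function of `u`, is a full set of first integrals. Its smoothness comes from the inverse function
theorem in the Banach space of continuous curves, applied to the Picard operator. The theorem itself
is `exists_local_casimir`; `Metric.connForm_eq_neg_lieDeriv`, `Metric.contravariantConnection_swap`
and `PoissonTensor.dense_regularSet` carry the rest. -/

noncomputable section

set_option synthInstance.maxHeartbeats 200000

/-! ### Calculus on spaces of continuous curves -/

namespace ContinuousMap

universe u
variable {K : Type*} [TopologicalSpace K] [CompactSpace K]

instance {G G' : Type*} [NormedAddCommGroup G] [NormedSpace ℝ G] [NormedAddCommGroup G']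
    [NormedSpace ℝ G'] : SeminormedAddCommGroup C(K, G →L[ℝ] G') :=
  NormedAddCommGroup.toSeminormedAddCommGroup

/-- Pointwise application of continuous families of continuous linear maps, as a continuous
linear map. -/
def pointwiseApply (K : Type*) [TopologicalSpace K] [CompactSpace K]
    (G G' : Type*) [NormedAddCommGroup G] [NormedSpace ℝ G]
    [NormedAddCommGroup G'] [NormedSpace ℝ G'] :
    C(K, G →L[ℝ] G') →L[ℝ] C(K, G) →L[ℝ] C(K, G') :=
  LinearMap.mkContinuous₂
    (LinearMap.mk₂ ℝ
      (fun (A : C(K, G →L[ℝ] G')) (c : C(K, G)) ↦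
        (⟨fun t ↦ A t (c t), A.continuous.clm_apply c.continuous⟩ : C(K, G')))
      (fun A A' c ↦ by ext t; simp) (fun r A c ↦ by ext t; simp)
      (fun A c c' ↦ by ext t; simp) (fun r A c ↦ by ext t; simp)) 1 fun A c ↦ by
    rw [one_mul, ContinuousMap.norm_le _ (by positivity)]
    intro t
    calc ‖A t (c t)‖ ≤ ‖A t‖ * ‖c t‖ := (A t).le_opNorm _
      _ ≤ ‖A‖ * ‖c‖ := by
        gcongr
        · exact A.norm_coe_le_norm t
        · exact c.norm_coe_le_norm t

@[simp] lemma pointwiseApply_apply {G G' : Type*} [NormedAddCommGroup G] [NormedSpace ℝ G]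
    [NormedAddCommGroup G'] [NormedSpace ℝ G'] (A : C(K, G →L[ℝ] G')) (c : C(K, G)) (t : K) :
    pointwiseApply K G G' A c t = A t (c t) := rfl

/-- The superposition (Nemytskii) operator of a `C¹` map is differentiable. -/
lemma hasFDerivAt_superposition {G G' : Type*} [NormedAddCommGroup G] [NormedSpace ℝ G]
    [NormedAddCommGroup G'] [NormedSpace ℝ G'] {H : G → G'} (hH : ContDiff ℝ 1 H) (c : C(K, G)) :
    HasFDerivAt (fun c : C(K, G) ↦ (⟨H, hH.continuous⟩ : C(G, G')).comp c)
      (pointwiseApply K G G' ((⟨fderiv ℝ H, hH.continuous_fderiv one_ne_zero⟩ :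
        C(G, G →L[ℝ] G')).comp c)) c := by
  set D : C(G, G →L[ℝ] G') := ⟨fderiv ℝ H, hH.continuous_fderiv one_ne_zero⟩
  rw [hasFDerivAt_iff_isLittleO, Asymptotics.isLittleO_iff]
  intro ε hε
  have hcont : ContinuousAt (fun c : C(K, G) ↦ D.comp c) c :=
    (ContinuousMap.continuous_postcomp D).continuousAt
  obtain ⟨δ, hδ, hδε⟩ := Metric.eventually_nhds_iff.1
    (hcont.eventually (Metric.ball_mem_nhds (D.comp c) hε))
  filter_upwards [Metric.ball_mem_nhds c hδ] with c' hc'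
  rw [ContinuousMap.norm_le _ (by positivity)]
  intro t
  have hball : ∀ z ∈ Metric.ball (c t) δ, ‖fderiv ℝ H z - fderiv ℝ H (c t)‖ ≤ ε := by
    intro z hz
    -- Shifting the whole curve `c` by the constant `z - c t` turns continuity of `c ↦ D ∘ c` in the
    -- sup norm into a bound with a `δ` independent of `t`.
    have h1 : dist (c + ContinuousMap.const K (z - c t)) c < δ := by
      rw [dist_eq_norm, add_sub_cancel_left]
      refine lt_of_le_of_lt ((ContinuousMap.norm_le _ (norm_nonneg (z - c t))).2 fun s ↦ ?_)
        (by rwa [Metric.mem_ball, dist_eq_norm] at hz)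
      simp
    have h2 := (ContinuousMap.dist_lt_iff hε).1 (Metric.mem_ball.1 (hδε h1)) t
    rw [dist_eq_norm] at h2
    simpa [D] using h2.le
  have hct : c' t ∈ Metric.ball (c t) δ :=
    lt_of_le_of_lt (ContinuousMap.dist_apply_le_dist t) hc'
  have key := (convex_ball (c t) δ).norm_image_sub_le_of_norm_hasFDerivWithin_le'
    (f := H) (f' := fderiv ℝ H) (φ := fderiv ℝ H (c t)) (C := ε)
    (fun z _ ↦ (hH.differentiable one_ne_zero z).hasFDerivAt.hasFDerivWithinAt) hball
    (Metric.mem_ball_self hδ) hct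
  calc _ = ‖H (c' t) - H (c t) - fderiv ℝ H (c t) (c' t - c t)‖ := by simp [D]
    _ ≤ ε * ‖c' t - c t‖ := key
    _ ≤ ε * ‖c' - c‖ := by
      gcongr
      exact (c' - c).norm_coe_le_norm t

/-- The superposition (Nemytskii) operator of a smooth map is smooth. -/
lemma contDiff_superposition {G : Type u} [NormedAddCommGroup G] [NormedSpace ℝ G] (n : ℕ) :
    ∀ {G' : Type u} [NormedAddCommGroup G'] [NormedSpace ℝ G'] {H : G → G'}
      (hH : ContDiff ℝ n H),
      ContDiff ℝ n (fun c : C(K, G) ↦ (⟨H, hH.continuous⟩ : C(G, G')).comp c) := by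
  induction n with
  | zero =>
    intro G' _ _ H hH
    simp only [Nat.cast_zero, contDiff_zero]
    exact ContinuousMap.continuous_postcomp _
  | succ n ih =>
    intro G' _ _ H hH
    have h1 : ContDiff ℝ 1 H := hH.of_le (by simp)
    have hd := hasFDerivAt_superposition (K := K) h1
    push_cast at hH ⊢
    rw [contDiff_succ_iff_fderiv] at hH ⊢
    refine ⟨fun c ↦ (hd c).differentiableAt, by simp, ?_⟩
    rw [funext fun c ↦ (hd c).fderiv]
    -- The derivative is again a superposition operator, that of `fderiv ℝ H`, with target `G →L[ℝ]
    -- G'`; hence the induction ranges over all targets, in the universe of `G`.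
    exact (pointwiseApply K G G').contDiff.comp (ih hH.2.2)

lemma contDiff_infty_superposition {G G' : Type u} [NormedAddCommGroup G] [NormedSpace ℝ G]
    [NormedAddCommGroup G'] [NormedSpace ℝ G'] {H : G → G'} (hH : ContDiff ℝ ∞ H) :
    ContDiff ℝ ∞ (fun c : C(K, G) ↦ (⟨H, hH.continuous⟩ : C(G, G')).comp c) :=
  contDiff_infty.2 fun n ↦ contDiff_superposition n (hH.of_le (by exact_mod_cast le_top))

/-- The operator `c ↦ (t ↦ ∫ s in 0..t, c s)` on continuous curves. -/
def primitive (F : Type*) [NormedAddCommGroup F] [NormedSpace ℝ F] [CompleteSpace F] :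
    C(unitInterval, F) →L[ℝ] C(unitInterval, F) :=
  LinearMap.mkContinuous
    { toFun c := ⟨fun t ↦ ∫ s in (0 : ℝ)..t, c (Set.projIcc 0 1 zero_le_one s),
        (intervalIntegral.continuous_primitive (fun a b ↦
          (c.continuous.comp continuous_projIcc).intervalIntegrable a b) 0).comp
          continuous_subtype_val⟩
      map_add' c c' := by
        ext t
        exact intervalIntegral.integral_add
          ((c.continuous.comp continuous_projIcc).intervalIntegrable _ _)
          ((c'.continuous.comp continuous_projIcc).intervalIntegrable _ _)
      map_smul' r c := by
        ext t
        exact intervalIntegral.integral_smul r _ } 1 fun c ↦ by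
    rw [one_mul, ContinuousMap.norm_le _ (by positivity)]
    intro t
    have := intervalIntegral.norm_integral_le_of_norm_le_const (a := (0 : ℝ)) (b := t)
      (f := fun s ↦ c (Set.projIcc 0 1 zero_le_one s)) (C := ‖c‖)
      (fun s _ ↦ c.norm_coe_le_norm _)
    refine this.trans ?_
    have h0 := t.2.1
    have h1 := t.2.2
    rw [sub_zero, abs_of_nonneg h0]
    exact mul_le_of_le_one_right (norm_nonneg _) h1

lemma primitive_apply {F : Type*} [NormedAddCommGroup F] [NormedSpace ℝ F] [CompleteSpace F]
    (c : C(unitInterval, F)) (t : unitInterval) :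
    primitive F c t = ∫ s in (0 : ℝ)..t, c (Set.projIcc 0 1 zero_le_one s) := rfl

end ContinuousMap
end

/-! ### The Picard operator of the transport equation -/

noncomputable section

set_option synthInstance.maxHeartbeats 200000

section FirstIntegral

universe u
variable {E : Type u} [NormedAddCommGroup E] [NormedSpace ℝ E]

/-- A map which is smooth on an open set agrees near any point of it with a globally smooth map. -/
lemma exists_contDiff_eventuallyEq [FiniteDimensional ℝ E] {F : Type*}
    [NormedAddCommGroup F] [NormedSpace ℝ F] {f : E → F} {W : Set E}
    (hW : IsOpen W) (hf : ContDiffOn ℝ ∞ f W) {x : E} (hx : x ∈ W) :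
    ∃ g : E → F, ContDiff ℝ ∞ g ∧ g =ᶠ[𝓝 x] f := by
  obtain ⟨r, hr, hrW⟩ := Metric.isOpen_iff.1 hW x hx
  let χ : ContDiffBump x := ⟨r / 4, r / 2, by positivity, by linarith⟩
  refine ⟨fun y ↦ χ y • f y, contDiff_iff_contDiffAt.2 fun y ↦ ?_, ?_⟩
  · by_cases hy : y ∈ W
    · exact χ.contDiffAt.smul (hf.contDiffAt (hW.mem_nhds hy))
    · have hy' : y ∈ (Metric.closedBall x (r / 2))ᶜ := fun h ↦
        hy (hrW (Metric.closedBall_subset_ball (by linarith) h))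
      refine (contDiffAt_const (c := (0 : F))).congr_of_eventuallyEq ?_
      filter_upwards [Metric.isClosed_closedBall.isOpen_compl.mem_nhds hy'] with z hz
      have : χ z = 0 := χ.zero_of_le_dist (by
        simp only [Set.mem_compl_iff, Metric.mem_closedBall, not_le] at hz
        exact hz.le)
      simp [this]
  · filter_upwards [χ.eventuallyEq_one] with y hy
    simp [hy]

variable (B : E → E →L[ℝ] E) (Q : E →L[ℝ] E) (u₀ : E)

open ContinuousMap

/-- The affine map sending `(u, c)` to the curve `(c, Q (u - u₀))`. -/
def transportCurve (p : E × C(unitInterval, E)) : C(unitInterval, E × E) :=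
  ((ContinuousLinearMap.inl ℝ E E).compLeftContinuous ℝ unitInterval) p.2 +
    ContinuousMap.const unitInterval ((0, Q (p.1 - u₀)) : E × E)

/-- The linear part of `transportCurve`. -/
def transportCurveLinear : E × C(unitInterval, E) →L[ℝ] C(unitInterval, E × E) :=
  ((ContinuousLinearMap.inl ℝ E E).compLeftContinuous ℝ unitInterval).comp
      (ContinuousLinearMap.snd ℝ _ _) +
    ((ContinuousLinearMap.const ℝ unitInterval).comp
      ((ContinuousLinearMap.inr ℝ E E).comp Q)).comp (ContinuousLinearMap.fst ℝ _ _)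

/-- The Picard operator of the equation `c' = -B(c) Q(u - u₀)`, `c(0) = u`, whose solutions are the
zeros of the second component. -/
def picardMap [CompleteSpace E] (hB : Continuous fun q : E × E ↦ B q.1 q.2)
    (p : E × C(unitInterval, E)) :
    E × C(unitInterval, E) :=
  (p.1, p.2 - ContinuousMap.const unitInterval p.1 +
    primitive E ((⟨fun q : E × E ↦ B q.1 q.2, hB⟩ : C(E × E, E)).comp (transportCurve Q u₀ p)))

/-- The derivative of `picardMap`. -/
def picardDeriv [CompleteSpace E] (hB : Continuous (fderiv ℝ fun q : E × E ↦ B q.1 q.2))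
    (p : E × C(unitInterval, E)) :
    E × C(unitInterval, E) →L[ℝ] E × C(unitInterval, E) :=
  (ContinuousLinearMap.fst ℝ _ _).prod
    (ContinuousLinearMap.snd ℝ _ _ -
      (ContinuousLinearMap.const ℝ unitInterval).comp (ContinuousLinearMap.fst ℝ _ _) +
    (primitive E).comp ((pointwiseApply unitInterval (E × E) E
      ((⟨fderiv ℝ fun q : E × E ↦ B q.1 q.2, hB⟩ : C(E × E, E × E →L[ℝ] E)).comp
        (transportCurve Q u₀ p))).comp (transportCurveLinear Q)))

lemma hasFDerivAt_transportCurve (p : E × C(unitInterval, E)) :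
    HasFDerivAt (transportCurve Q u₀) (transportCurveLinear Q) p := by
  have : transportCurve Q u₀ = fun p ↦ transportCurveLinear Q p -
      ContinuousMap.const unitInterval ((0, Q u₀) : E × E) := by
    ext p t <;> simp [transportCurve, transportCurveLinear]
  rw [this]
  exact (transportCurveLinear Q).hasFDerivAt.sub_const _

lemma contDiff_transportCurve : ContDiff ℝ ∞ (transportCurve Q u₀) := by
  have : transportCurve Q u₀ = fun p ↦ transportCurveLinear Q p -
      ContinuousMap.const unitInterval ((0, Q u₀) : E × E) := by
    ext p t <;> simp [transportCurve, transportCurveLinear]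
  rw [this]
  exact (transportCurveLinear Q).contDiff.sub contDiff_const

variable {B}

lemma contDiff_uncurry (hB : ContDiff ℝ ∞ B) : ContDiff ℝ ∞ fun q : E × E ↦ B q.1 q.2 :=
  (hB.comp contDiff_fst).clm_apply contDiff_snd

/-- The only nonlinear ingredient is the superposition operator of `(a, b) ↦ B a b`; all others are
affine and continuous. -/
lemma contDiff_picardMap [CompleteSpace E] (hB : ContDiff ℝ ∞ B) :
    ContDiff ℝ ∞ (picardMap B Q u₀ (contDiff_uncurry hB).continuous) := by
  refine contDiff_fst.prodMk ((contDiff_snd.sub ?_).add ?_)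
  · have hk : ContDiff ℝ ∞ fun w : E ↦ ContinuousMap.const unitInterval w :=
      (ContinuousLinearMap.const ℝ unitInterval : E →L[ℝ] C(unitInterval, E)).contDiff
    exact hk.comp contDiff_fst
  · exact (primitive E).contDiff.comp
      ((contDiff_infty_superposition (contDiff_uncurry hB)).comp (contDiff_transportCurve Q u₀))

lemma hasFDerivAt_picardMap [CompleteSpace E] (hB : ContDiff ℝ ∞ B) (p : E × C(unitInterval, E)) :
    HasFDerivAt (picardMap B Q u₀ (contDiff_uncurry hB).continuous)
      (picardDeriv B Q u₀ ((contDiff_uncurry hB).continuous_fderiv (by simp)) p) p := by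
  refine hasFDerivAt_fst.prodMk ((hasFDerivAt_snd.sub ?_).add ?_)
  · have hk : HasFDerivAt (fun w : E ↦ ContinuousMap.const unitInterval w)
        (ContinuousLinearMap.const ℝ unitInterval : E →L[ℝ] C(unitInterval, E)) p.1 :=
      (ContinuousLinearMap.const ℝ unitInterval : E →L[ℝ] C(unitInterval, E)).hasFDerivAt
    exact hk.comp p hasFDerivAt_fst
  · have h1 : ContDiff ℝ 1 fun q : E × E ↦ B q.1 q.2 := (contDiff_uncurry hB).of_le (by simp)
    have h2 := HasFDerivAt.comp p (hasFDerivAt_superposition h1 (transportCurve Q u₀ p))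
      (hasFDerivAt_transportCurve Q u₀ p)
    exact (primitive E).hasFDerivAt.comp p h2

lemma fderiv_uncurry (hB : ContDiff ℝ ∞ B) (a b a' b' : E) :
    fderiv ℝ (fun q : E × E ↦ B q.1 q.2) (a, b) (a', b') = fderiv ℝ B a a' b + B a b' := by
  have h1 : HasFDerivAt (fun q : E × E ↦ B q.1)
      ((fderiv ℝ B a).comp (ContinuousLinearMap.fst ℝ E E)) (a, b) :=
    ((hB.differentiable (by simp) a).hasFDerivAt).comp (a, b) hasFDerivAt_fst
  rw [(h1.clm_apply hasFDerivAt_snd).fderiv]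
  simp [add_comm]

lemma picardDeriv_apply [CompleteSpace E] (hB : ContDiff ℝ ∞ B) (p : E × C(unitInterval, E)) (w : E)
    (W : C(unitInterval, E)) :
    picardDeriv B Q u₀ ((contDiff_uncurry hB).continuous_fderiv (by simp)) p (w, W) =
      (w, W - ContinuousMap.const unitInterval w + primitive E
        ⟨fun t ↦ fderiv ℝ (fun q : E × E ↦ B q.1 q.2) (p.2 t, Q (p.1 - u₀)) (W t, Q w),
          (((contDiff_uncurry hB).continuous_fderiv (by simp)).comp
            (p.2.continuous.prodMk continuous_const)).clm_apply
            (W.continuous.prodMk continuous_const)⟩) := by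
  simp only [picardDeriv, ContinuousLinearMap.prod_apply, Prod.mk.injEq]
  refine ⟨rfl, ?_⟩
  simp only [_root_.add_apply, _root_.sub_apply, ContinuousLinearMap.comp_apply]
  congr 2
  ext t
  simp [transportCurve, transportCurveLinear, -map_add]

end FirstIntegral
end

/-! ### First integrals of an involutive distribution -/

noncomputable section

set_option synthInstance.maxHeartbeats 200000

section FirstIntegral

universe u
variable {E : Type u} [NormedAddCommGroup E] [NormedSpace ℝ E]
  {B : E → E →L[ℝ] E} (Q : E →L[ℝ] E) (u₀ : E)

open ContinuousMap

/-- If `B` spans an involutive distribution and `c` is the transport curve starting at `u`, then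
moving `u` in the direction `B u v` moves `c` by `(1 - t) B (c t) v`. -/
lemma picardDeriv_transport [CompleteSpace E] (hB : ContDiff ℝ ∞ B) {W : Set E}
    (hQB : ∀ u ∈ W, ∀ v, Q (B u v) = Q v) (hBQ : ∀ u ∈ W, ∀ v, B u (Q v) = B u v)
    (hint : ∀ u ∈ W, ∀ v w, fderiv ℝ B u (B u v) w = fderiv ℝ B u (B u w) v)
    {u : E} (hu : u ∈ W) {c : C(unitInterval, E)} (hc : ∀ t, c t ∈ W)
    (hz : picardMap B Q u₀ (contDiff_uncurry hB).continuous (u, c) = (u, 0)) (v : E) :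
    picardDeriv B Q u₀ ((contDiff_uncurry hB).continuous_fderiv (by simp)) (u, c)
      (B u v, ⟨fun t ↦ (1 - (t : ℝ)) • B (c t) v,
        (continuous_const.sub continuous_subtype_val).smul
          ((hB.continuous.comp c.continuous).clm_apply continuous_const)⟩) = (B u v, 0) := by
  set x : E := Q (u - u₀) with hx
  set C : ℝ → E := fun s ↦ c (Set.projIcc 0 1 zero_le_one s) with hC
  have hCc : Continuous C := c.continuous.comp continuous_projIcc
  have hBC : Continuous fun s ↦ B (C s) x :=
    (hB.continuous.comp hCc).clm_apply continuous_const
  -- The integral equation extends `c` to a curve `y` that is differentiable on all of `ℝ`, so no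
  -- one-sided derivatives occur; `y` and `c` agree on `[0, 1]`.
  set y : ℝ → E := fun t ↦ u - ∫ s in (0 : ℝ)..t, B (C s) x with hy
  have hyd (t : ℝ) : HasDerivAt y (-(B (C t) x)) t :=
    ((hBC.integral_hasStrictDerivAt 0 t).hasDerivAt).const_sub u
  have hcy (t : unitInterval) : c t = y t := by
    have h1 := congrArg (fun p : E × C(unitInterval, E) ↦ p.2 t) hz
    simp only [picardMap, ContinuousMap.add_apply, ContinuousMap.sub_apply, const_apply,
      primitive_apply, ContinuousMap.zero_apply] at h1
    have h2 : ∀ s, (⟨fun q : E × E ↦ B q.1 q.2, (contDiff_uncurry hB).continuous⟩ :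
        C(E × E, E)).comp (transportCurve Q u₀ (u, c)) s = B (c s) x := by
      intro s
      simp [transportCurve, hx]
    simp only [h2] at h1
    rw [sub_add_eq_add_sub, sub_eq_zero] at h1
    rw [hy, eq_sub_iff_add_eq]
    exact h1
  have hCy (t : ℝ) (ht : t ∈ Set.Icc (0 : ℝ) 1) : C t = y t := by
    rw [← show ((⟨t, ht⟩ : unitInterval) : ℝ) = t from rfl, ← hcy, hC]
    simp only [Set.projIcc_of_mem zero_le_one ht]
  have hyc : Continuous y := continuous_iff_continuousAt.2 fun t ↦ (hyd t).continuousAt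
  have hB' : Continuous (fderiv ℝ B) := hB.continuous_fderiv (by simp)
  set Z : ℝ → E := fun t ↦ (1 - t) • B (y t) v with hZ
  set Z' : ℝ → E := fun t ↦
    (1 - t) • fderiv ℝ B (y t) (-(B (C t) x)) v + (-1 : ℝ) • B (y t) v with hZ'
  have hZd (t : ℝ) : HasDerivAt Z (Z' t) t := by
    have h1 : HasDerivAt (fun t ↦ B (y t)) (fderiv ℝ B (y t) (-(B (C t) x))) t :=
      ((hB.differentiable (by simp) (y t)).hasFDerivAt).comp_hasDerivAt t (hyd t)
    have h2 : HasDerivAt (fun t ↦ B (y t) v) (fderiv ℝ B (y t) (-(B (C t) x)) v) t := by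
      simpa using h1.clm_apply (hasDerivAt_const t v)
    exact ((hasDerivAt_id t).const_sub 1).smul h2
  have hZ'c : Continuous Z' := by
    refine ((continuous_const.sub continuous_id).smul
      (((hB'.comp hyc).clm_apply hBC.neg).clm_apply continuous_const)).add
      (continuous_const.smul ((hB.continuous.comp hyc).clm_apply continuous_const))
  rw [picardDeriv_apply Q u₀ hB]
  refine Prod.ext rfl ?_
  ext t
  have h0 : y 0 = u := by simp [hy]
  -- The non-integral terms of the linearized Picard equation become the integral of `Z'`, so it
  -- suffices to cancel integrands.
  have hZint : ∫ s in (0 : ℝ)..t, Z' s = (1 - (t : ℝ)) • B (c t) v - B u v := by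
    rw [intervalIntegral.integral_eq_sub_of_hasDerivAt (fun s _ ↦ hZd s)
      (hZ'c.intervalIntegrable _ _), hZ, hcy]
    simp [h0]
  simp only [ContinuousMap.add_apply, ContinuousMap.sub_apply, ContinuousMap.zero_apply,
    const_apply, ContinuousMap.coe_mk, primitive_apply]
  rw [← hZint, ← intervalIntegral.integral_add (hZ'c.intervalIntegrable _ _)
    (Continuous.intervalIntegrable (by
      refine (((contDiff_uncurry hB).continuous_fderiv (by simp)).comp
        (hCc.prodMk continuous_const)).clm_apply (Continuous.prodMk ?_ continuous_const)
      exact (continuous_const.sub (continuous_subtype_val.comp continuous_projIcc)).smul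
        ((hB.continuous.comp hCc).clm_apply continuous_const)) _ _)]
  refine (intervalIntegral.integral_congr (g := fun _ ↦ (0 : E)) fun s hs ↦ ?_).trans (by simp)
  rw [Set.uIcc_of_le t.2.1] at hs
  have hs' : s ∈ Set.Icc (0 : ℝ) 1 := ⟨hs.1, hs.2.trans t.2.2⟩
  have hCW : C s ∈ W := hc _
  have hps : ((Set.projIcc 0 1 zero_le_one s : unitInterval) : ℝ) = s := by
    rw [Set.projIcc_of_mem _ hs']
  have hcC : c (Set.projIcc 0 1 zero_le_one s) = C s := rfl
  simp only [hZ', hcC, hps, fderiv_uncurry hB, ← hCy s hs', ← hx]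
  -- `Q (B u v) = Q v` and `B Q = B` cancel the terms without a derivative of `B`. In the other two,
  -- involutivity exchanges `v` and `x`.
  rw [hQB u hu, hBQ _ hCW v, map_neg, map_smul, _root_.neg_apply,
    _root_.smul_apply, hint _ hCW v x]
  module

/-- An involutive distribution spanned by the smooth family `B` has near every point a full set of
first integrals, the components of `f`. -/
theorem exists_firstIntegral [FiniteDimensional ℝ E] {W : Set E} (hW : IsOpen W) (hu₀ : u₀ ∈ W)
    (hBW : ContDiffOn ℝ ∞ B W)
    (hQB : ∀ u ∈ W, ∀ v, Q (B u v) = Q v) (hBQ : ∀ u ∈ W, ∀ v, B u (Q v) = B u v)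
    (hint : ∀ u ∈ W, ∀ v w, fderiv ℝ B u (B u v) w = fderiv ℝ B u (B u w) v) :
    ∃ (f : E → E) (U : Set E), IsOpen U ∧ u₀ ∈ U ∧ U ⊆ W ∧ ContDiffOn ℝ ∞ f U ∧
      (∀ u ∈ U, ∀ v, fderiv ℝ f u (B u v) = 0) ∧ ∀ w, fderiv ℝ f u₀ w = w - B u₀ w := by
  -- The Picard operator acts on all continuous curves, so `B` is replaced by a globally smooth map
  -- with the same germ at `u₀`.
  obtain ⟨B', hB', hBB'⟩ := exists_contDiff_eventuallyEq hW hBW hu₀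
  obtain ⟨W', hW'sub, hW', hu₀'⟩ := mem_nhds_iff.1 (hBB'.and (hW.mem_nhds hu₀))
  have hd (u : E) (hu : u ∈ W') : B' u = B u ∧ fderiv ℝ B' u = fderiv ℝ B u := by
    refine ⟨(hW'sub hu).1, Filter.EventuallyEq.fderiv_eq ?_⟩
    filter_upwards [hW'.mem_nhds hu] with z hz using (hW'sub hz).1
  have hQB' : ∀ u ∈ W', ∀ v, Q (B' u v) = Q v := fun u hu v ↦ by
    rw [(hd u hu).1, hQB u (hW'sub hu).2]
  have hBQ' : ∀ u ∈ W', ∀ v, B' u (Q v) = B' u v := fun u hu v ↦ by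
    rw [(hd u hu).1, hBQ u (hW'sub hu).2]
  have hint' : ∀ u ∈ W', ∀ v w, fderiv ℝ B' u (B' u v) w = fderiv ℝ B' u (B' u w) v :=
    fun u hu v w ↦ by rw [(hd u hu).1, (hd u hu).2, hint u (hW'sub hu).2]
  set Ψ := picardMap B' Q u₀ (contDiff_uncurry hB').continuous with hΨ
  set Ψ' := picardDeriv B' Q u₀ ((contDiff_uncurry hB').continuous_fderiv (by simp)) with hΨ'
  have hΨd (p) : HasFDerivAt Ψ (Ψ' p) p := hasFDerivAt_picardMap Q u₀ hB' p
  have hΨs : ContDiff ℝ ∞ Ψ := contDiff_picardMap Q u₀ hB'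
  have hΨc : Continuous Ψ' := by
    have : Ψ' = fderiv ℝ Ψ := funext fun p ↦ (hΨd p).fderiv.symm
    rw [this]
    exact hΨs.continuous_fderiv (by simp)
  let c₀ : C(unitInterval, E) := ContinuousMap.const _ u₀
  have hΨ0 : Ψ (u₀, c₀) = (u₀, 0) := by
    refine Prod.ext rfl ?_
    ext t
    simp [hΨ, picardMap, c₀, primitive_apply, transportCurve]
  -- At `u₀` the transport direction `Q (u - u₀)` vanishes, so the integrand does not depend on the
  -- variation `V` of the curve. The derivative is block triangular, `(w, V) ↦ (w, V + A₀ w)`, hence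
  -- invertible without any smallness estimate.
  let A₀ : E →L[ℝ] C(unitInterval, E) :=
    (primitive E).comp ((ContinuousLinearMap.const ℝ unitInterval).comp ((B' u₀).comp Q)) -
      ContinuousLinearMap.const ℝ unitInterval
  let e : (E × C(unitInterval, E)) ≃L[ℝ] E × C(unitInterval, E) :=
    (ContinuousLinearEquiv.refl ℝ E).skewProd (ContinuousLinearEquiv.refl ℝ _) A₀
  have he : Ψ' (u₀, c₀) = e := by
    refine ContinuousLinearMap.ext fun ⟨w, V⟩ ↦ ?_
    rw [hΨ', picardDeriv_apply Q u₀ hB']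
    refine Prod.ext rfl ?_
    ext t
    simp [e, A₀, c₀, primitive_apply, fderiv_uncurry hB']
    abel
  have hΨat : ContDiffAt ℝ ∞ Ψ (u₀, c₀) := hΨs.contDiffAt
  have hed : HasFDerivAt Ψ (e : E × C(unitInterval, E) →L[ℝ] E × C(unitInterval, E)) (u₀, c₀) :=
    he ▸ hΨd _
  -- Since `Ψ` keeps its first component, the local inverse sends `(u, 0)` to `u` together with its
  -- transport curve.
  let φ := hΨat.toOpenPartialHomeomorph Ψ hed (by simp)
  have hφs : (u₀, c₀) ∈ φ.source := hΨat.mem_toOpenPartialHomeomorph_source hed (by simp)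
  have hφt : (u₀, (0 : C(unitInterval, E))) ∈ φ.target := by
    rw [← hΨ0]; exact φ.map_source hφs
  have hφ0 : φ.symm (u₀, 0) = (u₀, c₀) := by
    rw [← hΨ0]; exact φ.left_inv hφs
  let ι : E → E × C(unitInterval, E) := fun u ↦ (u, 0)
  have hι : Continuous ι := by fun_prop
  -- points near the base point at which the local inverse has all required properties
  let O : Set (E × C(unitInterval, E)) :=
    {p | p.1 ∈ W' ∧ (∀ t, p.2 t ∈ W')} ∩ Ψ' ⁻¹' (Set.range
      ((↑) : ((E × C(unitInterval, E)) ≃L[ℝ] E × C(unitInterval, E)) → _ →L[ℝ] _))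
  have hO : IsOpen O := by
    refine IsOpen.inter ((hW'.preimage continuous_fst).inter ?_)
      ((ContinuousLinearEquiv.isOpen).preimage hΨc)
    have hset : {p : E × C(unitInterval, E) | ∀ t, p.2 t ∈ W'} =
        Prod.snd ⁻¹' {f : C(unitInterval, E) | Set.MapsTo f Set.univ W'} := by
      ext p
      simp [Set.MapsTo]
    change IsOpen {p : E × C(unitInterval, E) | ∀ t, p.2 t ∈ W'}
    rw [hset]
    exact (ContinuousMap.isOpen_setOfPred_mapsTo isCompact_univ hW').preimage continuous_snd
  have hO0 : (u₀, c₀) ∈ O := ⟨⟨hu₀', fun t ↦ hu₀'⟩, ⟨e, he.symm⟩⟩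
  let U : Set E := ι ⁻¹' (φ.target ∩ φ.symm ⁻¹' O)
  have hU : IsOpen U := (φ.isOpen_inter_preimage_symm hO).preimage hι
  have key (u : E) (hu : u ∈ U) : ∃ e' : (E × C(unitInterval, E)) ≃L[ℝ] E × C(unitInterval, E),
      (e' : E × C(unitInterval, E) →L[ℝ] E × C(unitInterval, E)) = Ψ' (φ.symm (u, 0)) ∧
      HasFDerivAt φ.symm (e'.symm : E × C(unitInterval, E) →L[ℝ] E × C(unitInterval, E)) (u, 0) ∧
      ContDiffAt ℝ ∞ φ.symm (u, 0) ∧ Ψ (φ.symm (u, 0)) = (u, 0) := by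
    obtain ⟨hut, _, e', he'⟩ := hu
    have hd' : HasFDerivAt φ (e' : E × C(unitInterval, E) →L[ℝ] E × C(unitInterval, E))
        (φ.symm (u, 0)) := by
      rw [he']; exact hΨd _
    exact ⟨e', he', φ.hasFDerivAt_symm hut hd',
      φ.contDiffAt_symm hut hd' hΨs.contDiffAt, φ.right_inv hut⟩
  let ev : E × C(unitInterval, E) →L[ℝ] E :=
    (ContinuousMap.evalCLM ℝ (1 : unitInterval)).comp (ContinuousLinearMap.snd ℝ _ _)
  have hιd (u : E) : HasFDerivAt ι (ContinuousLinearMap.inl ℝ E C(unitInterval, E)) u :=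
    (ContinuousLinearMap.inl ℝ E C(unitInterval, E)).hasFDerivAt
  have hfd (u : E) {L : E × C(unitInterval, E) →L[ℝ] E × C(unitInterval, E)}
      (hL : HasFDerivAt φ.symm L (u, 0)) (w : E) :
      fderiv ℝ (fun u ↦ (φ.symm (u, 0)).2 1) u w = (L (w, 0)).2 1 := by
    have h1 : HasFDerivAt (fun u ↦ ev (φ.symm (ι u)))
        (ev.comp (L.comp (ContinuousLinearMap.inl ℝ E C(unitInterval, E)))) u :=
      ev.hasFDerivAt.comp u (HasFDerivAt.comp u (g := φ.symm) hL (hιd u))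
    exact congrArg (fun T : E →L[ℝ] E ↦ T w) h1.fderiv
  have hu₀U : u₀ ∈ U := by
    refine ⟨hφt, ?_⟩
    change φ.symm (u₀, 0) ∈ O
    rw [hφ0]
    exact hO0
  -- The first integral is the endpoint of the transport curve starting at `u`.
  refine ⟨fun u ↦ (φ.symm (u, 0)).2 1, U, hU, hu₀U, ?_, ?_, ?_, ?_⟩
  · intro u hu
    obtain ⟨-, -, -, -, hr⟩ := key u hu
    have h1 : (φ.symm (u, 0)).1 = u := congrArg Prod.fst hr
    exact h1 ▸ (hW'sub hu.2.1.1).2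
  · intro u hu
    obtain ⟨-, -, -, hs, -⟩ := key u hu
    have h1 : ContDiffAt ℝ ∞ (fun u ↦ ev (φ.symm (ι u))) u :=
      ev.contDiff.contDiffAt.comp u (ContDiffAt.comp u (g := φ.symm) hs
        (ContinuousLinearMap.inl ℝ E C(unitInterval, E)).contDiff.contDiffAt)
    exact h1.contDiffWithinAt
  · intro u hu v
    obtain ⟨e', he', hs, -, hr⟩ := key u hu
    obtain ⟨-, ⟨hp1, hp2⟩, -⟩ := hu
    have h1 : (φ.symm (u, 0)).1 = u := congrArg Prod.fst hr
    obtain ⟨c, hc⟩ : ∃ c, φ.symm (u, 0) = (u, c) := ⟨_, Prod.ext h1 rfl⟩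
    change (φ.symm (u, 0)).1 ∈ W' at hp1
    change ∀ t, (φ.symm (u, 0)).2 t ∈ W' at hp2
    rw [hc] at hp1 hp2 he' hr
    have hT := picardDeriv_transport Q u₀ hB' hQB' hBQ' hint' hp1 hp2 hr v
    rw [← hΨ', ← he'] at hT
    rw [hfd u hs, ← (hd u hp1).1]
    -- Along `B u v` the curve varies by `(1 - t) B (c t) v`, which is zero at the endpoint `t = 1`.
    have hT' := (e'.symm_apply_eq).2 hT.symm
    change (e'.symm (B' u v, 0)).2 1 = 0
    rw [hT']
    simp
  · intro w
    obtain ⟨e', he', hs, -, -⟩ := key u₀ hu₀U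
    rw [hφ0, he] at he'
    have hee : e' = e := ContinuousLinearEquiv.coe_injective he'
    rw [hfd u₀ hs, hee]
    change (e.symm (w, 0)).2 1 = _
    rw [ContinuousLinearEquiv.skewProd_symm_apply]
    simp [A₀, primitive_apply, hBQ u₀ hu₀, (hd u₀ hu₀').1]

end FirstIntegral
end

/-! ### Frobenius' theorem for Poisson tensors on a vector space -/

noncomputable section

set_option synthInstance.maxHeartbeats 200000

section LocalCasimir

universe u
variable {E : Type u} [NormedAddCommGroup E] [NormedSpace ℝ E] [FiniteDimensional ℝ E]

omit [FiniteDimensional ℝ E] in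
lemma eq_of_forall_clm_eq {x y : E} (h : ∀ κ : E →L[ℝ] ℝ, κ x = κ y) : x = y :=
  (SeparatingDual.eq_iff_forall_dual_eq (R := ℝ)).2 h

/-- Every continuous linear map between finite-dimensional spaces has a generalized inverse. -/
lemma exists_generalizedInverse {F : Type*} [NormedAddCommGroup F] [NormedSpace ℝ F]
    (A : F →L[ℝ] E) : ∃ S : E →L[ℝ] F, ∀ x, A (S (A x)) = A x := by
  obtain ⟨r, hr⟩ := LinearMap.exists_rightInverse_of_surjective A.toLinearMap.rangeRestrict
    (LinearMap.range_rangeRestrict _)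
  obtain ⟨p, hp⟩ := LinearMap.exists_leftInverse_of_injective
    (LinearMap.range A.toLinearMap).subtype (Submodule.ker_subtype _)
  refine ⟨LinearMap.toContinuousLinearMap (r ∘ₗ p), fun x ↦ ?_⟩
  have h1 : p (A x) = A.toLinearMap.rangeRestrict x :=
    LinearMap.congr_fun hp (A.toLinearMap.rangeRestrict x)
  have h2 := LinearMap.congr_fun hr (A.toLinearMap.rangeRestrict x)
  simpa [h1] using congrArg Subtype.val h2

omit [FiniteDimensional ℝ E] in
/-- The characteristic distribution of a Poisson tensor is involutive: Hamiltonian vector fields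
with constant differentials have their bracket in the range of the anchor. -/
lemma bracket_mem_range {A : E → (E →L[ℝ] ℝ) →L[ℝ] E} {W : Set E} (hW : IsOpen W)
    (hA : DifferentiableOn ℝ A W) (hskew : ∀ u ∈ W, ∀ φ η : E →L[ℝ] ℝ, η (A u φ) = -φ (A u η))
    (hjac : ∀ u ∈ W, ∀ φ η κ : E →L[ℝ] ℝ, κ (fderiv ℝ A u (A u φ) η) +
      φ (fderiv ℝ A u (A u η) κ) + η (fderiv ℝ A u (A u κ) φ) = 0)
    {u : E} (hu : u ∈ W) (φ η : E →L[ℝ] ℝ) :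
    ∃ ζ, fderiv ℝ A u (A u φ) η - fderiv ℝ A u (A u η) φ = A u ζ := by
  have hAd : HasFDerivAt A (fderiv ℝ A u) u :=
    ((hA u hu).differentiableAt (hW.mem_nhds hu)).hasFDerivAt
  have hd (φ η : E →L[ℝ] ℝ) : HasFDerivAt (fun u ↦ η (A u φ))
      (η.comp ((fderiv ℝ A u).flip φ)) u := by
    have h1 : HasFDerivAt (fun u ↦ A u φ) ((fderiv ℝ A u).flip φ) u := by
      have := hAd.clm_apply (hasFDerivAt_const φ u)
      simpa using this
    exact η.hasFDerivAt.comp u h1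
  have hskew' (φ η : E →L[ℝ] ℝ) (x : E) : η (fderiv ℝ A u x φ) = -φ (fderiv ℝ A u x η) := by
    have h1 : (fun u ↦ η (A u φ)) =ᶠ[𝓝 u] fun u ↦ -φ (A u η) := by
      filter_upwards [hW.mem_nhds hu] with z hz using hskew z hz φ η
    have h2 := (hd φ η).unique ((hd η φ).neg.congr_of_eventuallyEq h1)
    exact congrArg (fun T : E →L[ℝ] ℝ ↦ T x) h2
  -- The witness is the differential of `u ↦ η (A u φ)`, the bracket of the linear functions `φ` and
  -- `η`: the commutator of two Hamiltonian fields is the Hamiltonian field of the bracket.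
  refine ⟨η.comp ((fderiv ℝ A u).flip φ), eq_of_forall_clm_eq fun κ ↦ ?_⟩
  rw [hskew u hu, map_sub]
  have h1 := hjac u hu φ η κ
  have h2 := hskew' κ φ (A u η)
  simp only [ContinuousLinearMap.comp_apply, ContinuousLinearMap.flip_apply]
  linarith

/-- **Frobenius theorem for Poisson tensors.** Where the rank of a Poisson tensor is constant,
every covector in the kernel of the anchor is the differential of a local Casimir function. -/
theorem exists_local_casimir {A : E → (E →L[ℝ] ℝ) →L[ℝ] E} {W : Set E} (hW : IsOpen W)
    (hA : ContDiffOn ℝ ∞ A W) (hskew : ∀ u ∈ W, ∀ φ η : E →L[ℝ] ℝ, η (A u φ) = -φ (A u η))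
    (hjac : ∀ u ∈ W, ∀ φ η κ : E →L[ℝ] ℝ, κ (fderiv ℝ A u (A u φ) η) +
      φ (fderiv ℝ A u (A u η) κ) + η (fderiv ℝ A u (A u κ) φ) = 0)
    {u₀ : E} (hu₀ : u₀ ∈ W)
    (hrank : ∀ u ∈ W, Module.finrank ℝ (LinearMap.range (A u).toLinearMap) =
      Module.finrank ℝ (LinearMap.range (A u₀).toLinearMap))
    {θ : E →L[ℝ] ℝ} (hθ : A u₀ θ = 0) :
    ∃ (f : E → ℝ) (U : Set E), IsOpen U ∧ u₀ ∈ U ∧ U ⊆ W ∧ ContDiffOn ℝ ∞ f U ∧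
      fderiv ℝ f u₀ = θ ∧ ∀ u ∈ U, A u (fderiv ℝ f u) = 0 := by
  obtain ⟨S₀, hS₀⟩ := exists_generalizedInverse (A u₀)
  -- `Q` is a projection onto the range of `A u₀`, and `S` below satisfies `A u₀ ∘ S = Q`.
  set Q : E →L[ℝ] E := (A u₀).comp S₀ with hQ
  have hQA (φ) : Q (A u₀ φ) = A u₀ φ := hS₀ φ
  have hQQ (x) : Q (Q x) = Q x := hQA _
  set S : E →L[ℝ] E →L[ℝ] ℝ := S₀.comp Q with hS
  have hSQ (x) : S (Q x) = S x := by simp only [hS, ContinuousLinearMap.comp_apply, hQQ]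
  have hAS (x) : A u₀ (S x) = Q x := hQQ x
  -- Adding `1 - Q` makes `T u₀ = 1`, so `T u` is invertible near `u₀`. Correcting `A u ∘ S` by this
  -- inverse gives the normalization `Q (B u v) = Q v`.
  let T : E → E →L[ℝ] E := fun u ↦ (Q.comp ((A u).comp S)) + (1 - Q)
  have hT : ContDiffOn ℝ ∞ T W :=
    (contDiffOn_const.clm_comp (hA.clm_comp contDiffOn_const)).add contDiffOn_const
  have hT₀ : T u₀ = 1 := by
    ext x
    simp [T, hAS, hQQ]
  set W₁ : Set E := W ∩ T ⁻¹' {a | IsUnit a} with hW₁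
  have hW₁o : IsOpen W₁ := hT.continuousOn.isOpen_inter_preimage hW Units.isOpen
  have hu₀₁ : u₀ ∈ W₁ := ⟨hu₀, by simp [hT₀]⟩
  let Ti : E → E →L[ℝ] E := fun u ↦ Ring.inverse (T u)
  have hTi : ContDiffOn ℝ ∞ Ti W₁ := by
    intro u hu
    obtain ⟨a, ha⟩ := hu.2
    have h1 : ContDiffAt ℝ ∞ Ring.inverse (T u) := ha ▸ contDiffAt_ringInverse ℝ a
    exact h1.comp_contDiffWithinAt u ((hT u hu.1).mono Set.inter_subset_left)
  have hTTi (u) (hu : u ∈ W₁) (x : E) : T u (Ti u x) = x := by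
    have := Ring.mul_inverse_cancel (T u) hu.2
    exact congrArg (fun a : E →L[ℝ] E ↦ a x) this
  have hTiT (u) (hu : u ∈ W₁) (x : E) : Ti u (T u x) = x := by
    have := Ring.inverse_mul_cancel (T u) hu.2
    exact congrArg (fun a : E →L[ℝ] E ↦ a x) this
  have hQT (u x) : Q (T u x) = Q (A u (S x)) := by simp [T, hQQ]
  have hTQ (u x) : T u (Q x) = Q (A u (S x)) := by simp [T, hQQ, hSQ]
  let C : E → E →L[ℝ] E →L[ℝ] ℝ := fun u ↦ S.comp ((Ti u).comp Q)
  have hC : ContDiffOn ℝ ∞ C W₁ := contDiffOn_const.clm_comp (hTi.clm_comp contDiffOn_const)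
  let B : E → E →L[ℝ] E := fun u ↦ (A u).comp (C u)
  have hB : ContDiffOn ℝ ∞ B W₁ := (hA.mono Set.inter_subset_left).clm_comp hC
  have hQB (u) (hu : u ∈ W₁) (v) : Q (B u v) = Q v := by
    change Q (A u (S (Ti u (Q v)))) = Q v
    rw [← hQT, hTTi u hu, hQQ]
  have hBQ (u) (_ : u ∈ W₁) (v) : B u (Q v) = B u v := by
    simp only [B, C, ContinuousLinearMap.comp_apply, hQQ]
  have hQr : LinearMap.range Q.toLinearMap = LinearMap.range (A u₀).toLinearMap := by
    refine le_antisymm ?_ ?_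
    · rintro _ ⟨x, rfl⟩
      exact ⟨S₀ x, rfl⟩
    · rintro _ ⟨φ, rfl⟩
      exact ⟨A u₀ φ, hQA φ⟩
  -- Constancy of the rank enters here: `Q` maps the range of `B u` onto the range of `A u₀`, so the
  -- range of `B u` is too large to be a proper subspace of that of `A u`.
  have hrange (u) (hu : u ∈ W₁) (φ) : ∃ z, A u φ = B u z := by
    have hle : LinearMap.range (B u).toLinearMap ≤ LinearMap.range (A u).toLinearMap := by
      rintro _ ⟨x, rfl⟩
      exact ⟨C u x, rfl⟩
    have hmap : (LinearMap.range (B u).toLinearMap).map Q.toLinearMap =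
        LinearMap.range Q.toLinearMap := by
      rw [← LinearMap.range_comp]
      congr 1
      ext x
      exact hQB u hu x
    have heq : LinearMap.range (B u).toLinearMap = LinearMap.range (A u).toLinearMap := by
      refine Submodule.eq_of_le_of_finrank_le hle ?_
      rw [hrank u hu.1, ← hQr, ← hmap]
      exact Submodule.finrank_map_le _ _
    obtain ⟨z, hz⟩ : A u φ ∈ LinearMap.range (B u).toLinearMap := heq ▸ ⟨φ, rfl⟩
    exact ⟨z, hz.symm⟩
  have hint (u) (hu : u ∈ W₁) (v w) :
      fderiv ℝ B u (B u v) w = fderiv ℝ B u (B u w) v := by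
    have hAd : HasFDerivAt A (fderiv ℝ A u) u :=
      ((hA.contDiffAt (hW.mem_nhds hu.1)).differentiableAt (by simp)).hasFDerivAt
    have hCd : HasFDerivAt C (fderiv ℝ C u) u :=
      ((hC.contDiffAt (hW₁o.mem_nhds hu)).differentiableAt (by simp)).hasFDerivAt
    have hBd (w x : E) : fderiv ℝ B u x w =
        fderiv ℝ A u x (C u w) + A u (fderiv ℝ C u x w) := by
      rw [(hAd.clm_comp hCd).fderiv]
      simp [add_comm]
    have hQd (w x : E) : Q (fderiv ℝ B u x w) = 0 := by
      have hBd' : HasFDerivAt B (fderiv ℝ B u) u :=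
        ((hB.contDiffAt (hW₁o.mem_nhds hu)).differentiableAt (by simp)).hasFDerivAt
      have h1 : HasFDerivAt (fun u ↦ Q (B u w)) (Q.comp ((fderiv ℝ B u).flip w)) u := by
        have h2 : HasFDerivAt (fun u ↦ B u w) ((fderiv ℝ B u).flip w) u := by
          simpa using hBd'.clm_apply (hasFDerivAt_const w u)
        exact Q.hasFDerivAt.comp u h2
      have h3 : (fun u ↦ Q (B u w)) =ᶠ[𝓝 u] fun _ ↦ Q w := by
        filter_upwards [hW₁o.mem_nhds hu] with z hz using hQB z hz w
      exact congrArg (fun L : E →L[ℝ] E ↦ L x)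
        (h1.unique ((hasFDerivAt_const (Q w) u).congr_of_eventuallyEq h3))
    -- The commutator of `B v` and `B w` has the form `B u z` by involutivity. It is killed by `Q`,
    -- because `Q ∘ B` is constant in `u`; so `Q z = 0` and `B u z = B u (Q z) = 0`.
    obtain ⟨ζ, hζ⟩ := bracket_mem_range hW (hA.differentiableOn (by simp)) hskew hjac hu.1
      (C u v) (C u w)
    obtain ⟨z, hz⟩ := hrange u hu (ζ + fderiv ℝ C u (B u v) w - fderiv ℝ C u (B u w) v)
    have hdiff : fderiv ℝ B u (B u v) w - fderiv ℝ B u (B u w) v = B u z := by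
      rw [← hz, map_sub, map_add, ← hζ, hBd, hBd]
      change _ = fderiv ℝ A u (B u v) (C u w) - fderiv ℝ A u (B u w) (C u v) + _ - _
      abel
    have hQz : Q z = 0 := by
      rw [← hQB u hu, ← hdiff, map_sub, hQd, hQd, sub_zero]
    rw [← sub_eq_zero, hdiff, ← hBQ u hu, hQz, map_zero]
  obtain ⟨f, U, hU, hu₀U, hUW, hf, hfB, hf₀⟩ :=
    exists_firstIntegral Q u₀ hW₁o hu₀₁ hB hQB hBQ hint
  have hd (u) (hu : u ∈ U) : fderiv ℝ (fun u ↦ θ (f u)) u = θ.comp (fderiv ℝ f u) :=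
    (θ.hasFDerivAt.comp u ((hf.contDiffAt (hU.mem_nhds hu)).differentiableAt
      (by simp)).hasFDerivAt).fderiv
  -- By skewness `θ` kills the range of `A u₀`, so composing with `θ` gives differential `θ` at
  -- `u₀`. Likewise, a differential that kills the range of `A u` lies in its kernel.
  refine ⟨fun u ↦ θ (f u), U, hU, hu₀U, hUW.trans Set.inter_subset_left,
    θ.contDiff.comp_contDiffOn hf, ?_, fun u hu ↦ eq_of_forall_clm_eq fun κ ↦ ?_⟩
  · rw [hd u₀ hu₀U]
    ext w
    have : θ (B u₀ w) = 0 := by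
      change θ (A u₀ (C u₀ w)) = 0
      rw [hskew u₀ hu₀, hθ, map_zero, neg_zero]
    simp [hf₀, this]
  · obtain ⟨z, hz⟩ := hrange u (hUW hu) κ
    rw [hskew u (hUW hu).1, hz, hd u hu]
    simp [hfB u hu]

end LocalCasimir
end

/-! ### Regularity of pairings, the anchor and the musical isomorphisms -/

noncomputable section

namespace PoissonRiemann

variable {E : Type*} [NormedAddCommGroup E] [NormedSpace ℝ E]
  {M : Type*} [TopologicalSpace M] [ChartedSpace E M] [IsManifold 𝓘(ℝ, E) ∞ M]

/-- The vector field `X` is differentiable at `x`. -/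
def VFieldDiffAt (X : VField E M) (x : M) : Prop :=
  MDifferentiableAt 𝓘(ℝ, E) (𝓘(ℝ, E).prod 𝓘(ℝ, E))
    (fun y ↦ TotalSpace.mk' E (E := fun y : M ↦ TangentSpace 𝓘(ℝ, E) y) y (X y)) x

/-- The vector field `X` is smooth at `x`. -/
def VFieldSmoothAt (X : VField E M) (x : M) : Prop :=
  ContMDiffAt 𝓘(ℝ, E) (𝓘(ℝ, E).prod 𝓘(ℝ, E)) ∞
    (fun y ↦ TotalSpace.mk' E (E := fun y : M ↦ TangentSpace 𝓘(ℝ, E) y) y (X y)) x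

/-- The 1-form `α` is differentiable at `x`. -/
def FormDiffAt (α : Form E M) (x : M) : Prop :=
  MDifferentiableAt 𝓘(ℝ, E) (𝓘(ℝ, E).prod 𝓘(ℝ, E →L[ℝ] ℝ))
    (fun y ↦ TotalSpace.mk' (E →L[ℝ] ℝ) (E := fun y : M ↦ TangentSpace 𝓘(ℝ, E) y →L[ℝ] ℝ)
      y (α y)) x

/-- The 1-form `α` is smooth at `x`. -/
def FormSmoothAt (α : Form E M) (x : M) : Prop :=
  ContMDiffAt 𝓘(ℝ, E) (𝓘(ℝ, E).prod 𝓘(ℝ, E →L[ℝ] ℝ)) ∞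
    (fun y ↦ TotalSpace.mk' (E →L[ℝ] ℝ) (E := fun y : M ↦ TangentSpace 𝓘(ℝ, E) y →L[ℝ] ℝ)
      y (α y)) x

variable {α β : Form E M} {X Y : VField E M} {x : M} {U : Set M}

lemma VFieldSmoothAt.diffAt (h : VFieldSmoothAt X x) : VFieldDiffAt X x :=
  ContMDiffAt.mdifferentiableAt h (by simp)

lemma FormSmoothAt.diffAt (h : FormSmoothAt α x) : FormDiffAt α x :=
  ContMDiffAt.mdifferentiableAt h (by simp)

lemma SmoothForm.smoothAt (h : SmoothForm α U) (hU : U ∈ 𝓝 x) : FormSmoothAt α x :=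
  ContMDiffOn.contMDiffAt h hU

lemma smoothForm_of_forall (h : ∀ x ∈ U, FormSmoothAt α x) : SmoothForm α U :=
  fun x hx ↦ ContMDiffAt.contMDiffWithinAt (h x hx)

lemma FormDiffAt.pair (hα : FormDiffAt α x) (hX : VFieldDiffAt X x) :
    MDifferentiableAt 𝓘(ℝ, E) 𝓘(ℝ, ℝ) (pair α X) x := by
  have h : MDifferentiableAt 𝓘(ℝ, E) (𝓘(ℝ, E).prod 𝓘(ℝ, ℝ))
      (fun y ↦ TotalSpace.mk' ℝ (E := Bundle.Trivial M ℝ) y (α y (X y))) x :=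
    MDifferentiableAt.clm_bundle_apply (F₁ := E) (F₂ := ℝ)
      (E₁ := fun y : M ↦ TangentSpace 𝓘(ℝ, E) y) (E₂ := Bundle.Trivial M ℝ) hα hX
  simp only [mdifferentiableAt_totalSpace] at h
  exact h.2

lemma FormSmoothAt.pair (hα : FormSmoothAt α x) (hX : VFieldSmoothAt X x) :
    ContMDiffAt 𝓘(ℝ, E) 𝓘(ℝ, ℝ) ∞ (pair α X) x := by
  have h : ContMDiffAt 𝓘(ℝ, E) (𝓘(ℝ, E).prod 𝓘(ℝ, ℝ)) ∞
      (fun y ↦ TotalSpace.mk' ℝ (E := Bundle.Trivial M ℝ) y (α y (X y))) x :=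
    ContMDiffAt.clm_bundle_apply (F₁ := E) (F₂ := ℝ)
      (E₁ := fun y : M ↦ TangentSpace 𝓘(ℝ, E) y) (E₂ := Bundle.Trivial M ℝ) hα hX
  simp only [contMDiffAt_totalSpace] at h
  exact h.2

namespace PoissonTensor
variable (P : PoissonTensor E M)

lemma sharp_diffAt (hα : FormDiffAt α x) : VFieldDiffAt (P.sharp α) x :=
  MDifferentiableAt.clm_bundle_apply (F₁ := E →L[ℝ] ℝ) (F₂ := E)
    (E₁ := fun y : M ↦ TangentSpace 𝓘(ℝ, E) y →L[ℝ] ℝ) (E₂ := fun y : M ↦ TangentSpace 𝓘(ℝ, E) y)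
    ((P.smooth x).mdifferentiableAt (by simp)) hα

lemma sharp_smoothAt (hα : FormSmoothAt α x) : VFieldSmoothAt (P.sharp α) x :=
  ContMDiffAt.clm_bundle_apply (F₁ := E →L[ℝ] ℝ) (F₂ := E)
    (E₁ := fun y : M ↦ TangentSpace 𝓘(ℝ, E) y →L[ℝ] ℝ) (E₂ := fun y : M ↦ TangentSpace 𝓘(ℝ, E) y)
    (P.smooth x) hα

end PoissonTensor

/-- The differential of a smooth function is smooth. -/
lemma diff_smoothAt {f : M → ℝ} (hf : ContMDiffAt 𝓘(ℝ, E) 𝓘(ℝ, ℝ) ∞ f x) :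
    FormSmoothAt (E := E) (diff f) x := by
  have h := hf.mfderiv_const (m := ∞) (by simp)
  refine (contMDiffAt_hom_bundle (F₁ := E) (F₂ := ℝ) (IB := 𝓘(ℝ, E))
    (E₁ := fun y : M ↦ TangentSpace 𝓘(ℝ, E) y) (E₂ := Bundle.Trivial M ℝ) _).2
    ⟨contMDiffAt_id, ?_⟩
  refine h.congr_of_eventuallyEq (Filter.Eventually.of_forall fun y ↦ ?_)
  simp only [inTangentCoordinates, ContinuousLinearMap.inCoordinates]
  ext v
  simp [diff, mvfderiv]
  rfl

namespace Metric
variable (g : Metric E M)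

lemma flat_diffAt (hX : VFieldDiffAt X x) : FormDiffAt (g.flat X) x :=
  MDifferentiableAt.clm_bundle_apply (F₁ := E) (F₂ := E →L[ℝ] ℝ)
    (E₁ := fun y : M ↦ TangentSpace 𝓘(ℝ, E) y) (E₂ := fun y : M ↦ TangentSpace 𝓘(ℝ, E) y →L[ℝ] ℝ)
    ((g.contMDiff x).mdifferentiableAt (by simp)) hX

lemma flat_smoothAt (hX : VFieldSmoothAt X x) : FormSmoothAt (g.flat X) x :=
  ContMDiffAt.clm_bundle_apply (F₁ := E) (F₂ := E →L[ℝ] ℝ)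
    (E₁ := fun y : M ↦ TangentSpace 𝓘(ℝ, E) y) (E₂ := fun y : M ↦ TangentSpace 𝓘(ℝ, E) y →L[ℝ] ℝ)
    (g.contMDiff x) hX

variable [FiniteDimensional ℝ E]

@[simp] lemma inner_sharp (α : Form E M) (x : M) : g.inner x (g.sharp α x) = α x :=
  (LinearEquiv.ofBijective (g.inner x).toLinearMap (g.inner_bijective x)).apply_symm_apply (α x)

@[simp] lemma flat_sharp (α : Form E M) : g.flat (g.sharp α) = α :=
  funext fun x ↦ g.inner_sharp α x

@[simp] lemma sharp_flat (X : VField E M) : g.sharp (g.flat X) = X :=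
  funext fun x ↦ (LinearEquiv.ofBijective (g.inner x).toLinearMap
    (g.inner_bijective x)).symm_apply_apply (X x)

lemma isInvertible_inner (x : M) : (g.inner x).IsInvertible := by
  have : FiniteDimensional ℝ (TangentSpace 𝓘(ℝ, E) x) := inferInstanceAs (FiniteDimensional ℝ E)
  have : T2Space (TangentSpace 𝓘(ℝ, E) x) := inferInstanceAs (T2Space E)
  exact ⟨(LinearEquiv.ofBijective (g.inner x).toLinearMap
    (g.inner_bijective x)).toContinuousLinearEquiv, rfl⟩

lemma sharp_eq_inverse (α : Form E M) (x : M) : g.sharp α x = (g.inner x).inverse (α x) := by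
  obtain ⟨e, he⟩ := g.isInvertible_inner x
  rw [← g.inner_sharp α x, ← he]
  simp

/-- The cometric is smooth. -/
lemma contMDiffAt_inverse (x : M) :
    ContMDiffAt 𝓘(ℝ, E) (𝓘(ℝ, E).prod 𝓘(ℝ, (E →L[ℝ] ℝ) →L[ℝ] E)) ∞
      (fun x ↦ TotalSpace.mk' ((E →L[ℝ] ℝ) →L[ℝ] E)
        (E := fun x : M ↦ (TangentSpace 𝓘(ℝ, E) x →L[ℝ] ℝ) →L[ℝ] TangentSpace 𝓘(ℝ, E) x)
        x (g.inner x).inverse) x := by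
  have hg := (contMDiffAt_hom_bundle (F₁ := E) (F₂ := E →L[ℝ] ℝ) (IB := 𝓘(ℝ, E))
    (E₁ := fun y : M ↦ TangentSpace 𝓘(ℝ, E) y) (E₂ := fun y : M ↦ TangentSpace 𝓘(ℝ, E) y →L[ℝ] ℝ)
    _).1 (g.contMDiff x)
  refine (contMDiffAt_hom_bundle (F₁ := E →L[ℝ] ℝ) (F₂ := E) (IB := 𝓘(ℝ, E))
    (E₁ := fun y : M ↦ TangentSpace 𝓘(ℝ, E) y →L[ℝ] ℝ) (E₂ := fun y : M ↦ TangentSpace 𝓘(ℝ, E) y)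
    _).2 ⟨contMDiffAt_id, ?_⟩
  have hx := FiberBundle.mem_baseSet_trivializationAt' (F := E)
    (E := fun y : M ↦ TangentSpace 𝓘(ℝ, E) y) x
  have hx' := FiberBundle.mem_baseSet_trivializationAt' (F := E →L[ℝ] ℝ)
    (E := fun y : M ↦ TangentSpace 𝓘(ℝ, E) y →L[ℝ] ℝ) x
  -- In trivializations the cometric is the pointwise inverse of the metric, and inversion is smooth
  -- at invertible maps.
  have hinv : ContMDiffAt 𝓘(ℝ, E) 𝓘(ℝ, (E →L[ℝ] ℝ) →L[ℝ] E) ∞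
      (ContinuousLinearMap.inverse ∘ fun y ↦ ContinuousLinearMap.inCoordinates E
        (fun y : M ↦ TangentSpace 𝓘(ℝ, E) y) (E →L[ℝ] ℝ)
        (fun y : M ↦ TangentSpace 𝓘(ℝ, E) y →L[ℝ] ℝ) x y x y (g.inner y)) x := by
    refine ContMDiffAt.comp x ?_ hg.2
    refine ContDiffAt.contMDiffAt (ContinuousLinearMap.IsInvertible.contDiffAt_map_inverse ?_)
    rw [ContinuousLinearMap.inCoordinates_eq hx hx']
    exact ContinuousLinearMap.isInvertible_equiv.comp
      ((g.isInvertible_inner x).comp ContinuousLinearMap.isInvertible_equiv)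
  refine hinv.congr_of_eventuallyEq ?_
  filter_upwards [(trivializationAt E (fun y : M ↦ TangentSpace 𝓘(ℝ, E) y) x).open_baseSet.mem_nhds
    hx, (trivializationAt (E →L[ℝ] ℝ) (fun y : M ↦ TangentSpace 𝓘(ℝ, E) y →L[ℝ] ℝ)
      x).open_baseSet.mem_nhds hx'] with y hy hy'
  simp only [Function.comp_apply]
  rw [ContinuousLinearMap.inCoordinates_eq hy hy', ContinuousLinearMap.inCoordinates_eq hy' hy]
  simp only [ContinuousLinearMap.inverse_equiv_comp, ContinuousLinearMap.inverse_comp_equiv,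
    ContinuousLinearEquiv.symm_symm]
  rfl

lemma sharp_diffAt (hα : FormDiffAt α x) : VFieldDiffAt (g.sharp α) x := by
  rw [funext (g.sharp_eq_inverse α)]
  exact MDifferentiableAt.clm_bundle_apply (F₁ := E →L[ℝ] ℝ) (F₂ := E)
    (E₁ := fun y : M ↦ TangentSpace 𝓘(ℝ, E) y →L[ℝ] ℝ) (E₂ := fun y : M ↦ TangentSpace 𝓘(ℝ, E) y)
    ((g.contMDiffAt_inverse x).mdifferentiableAt (by simp)) hα

lemma sharp_smoothAt (hα : FormSmoothAt α x) : VFieldSmoothAt (g.sharp α) x := by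
  rw [funext (g.sharp_eq_inverse α)]
  exact ContMDiffAt.clm_bundle_apply (F₁ := E →L[ℝ] ℝ) (F₂ := E)
    (E₁ := fun y : M ↦ TangentSpace 𝓘(ℝ, E) y →L[ℝ] ℝ) (E₂ := fun y : M ↦ TangentSpace 𝓘(ℝ, E) y)
    (g.contMDiffAt_inverse x) hα

end Metric

end PoissonRiemann
end

noncomputable section

namespace PoissonRiemann

variable {E : Type*} [NormedAddCommGroup E] [NormedSpace ℝ E]
  {M : Type*} [TopologicalSpace M] [ChartedSpace E M] [IsManifold 𝓘(ℝ, E) ∞ M]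

lemma two_le_infty : (2 : WithTop ℕ∞) ≤ ∞ := WithTop.coe_le_coe.2 le_top

/-! ### Reading derivatives in a chart -/

/-- The derivative at `y` of the chart centred at `p`. -/
def chartDeriv (p y : M) : TangentSpace 𝓘(ℝ, E) y →L[ℝ] E :=
  mvfderiv 𝓘(ℝ, E) (extChartAt 𝓘(ℝ, E) p) y

variable {p y x : M} {X Y : VField E M} {f : M → ℝ}

lemma isInvertible_chartDeriv (hy : y ∈ (extChartAt 𝓘(ℝ, E) p).source) :
    (chartDeriv (E := E) p y).IsInvertible :=
  have : IsManifold 𝓘(ℝ, E) 1 M := .of_le (n := ∞) (by simp)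
  isInvertible_mfderiv_extChartAt hy

lemma mdifferentiableAt_comp_symm (hy : y ∈ (extChartAt 𝓘(ℝ, E) p).source)
    (hf : MDifferentiableAt 𝓘(ℝ, E) 𝓘(ℝ, ℝ) f y) :
    DifferentiableAt ℝ (f ∘ (extChartAt 𝓘(ℝ, E) p).symm) (extChartAt 𝓘(ℝ, E) p y) := by
  have h1 : ContMDiffAt 𝓘(ℝ, E) 𝓘(ℝ, E) ∞ (extChartAt 𝓘(ℝ, E) p).symm (extChartAt 𝓘(ℝ, E) p y) :=
    (contMDiffOn_extChartAt_symm p).contMDiffAt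
      ((isOpen_extChartAt_target p).mem_nhds ((extChartAt 𝓘(ℝ, E) p).map_source hy))
  refine MDifferentiableAt.differentiableAt ?_
  refine MDifferentiableAt.comp _ ?_ (h1.mdifferentiableAt (by simp))
  rwa [(extChartAt 𝓘(ℝ, E) p).left_inv hy]

lemma contDiffAt_comp_symm (hy : y ∈ (extChartAt 𝓘(ℝ, E) p).source)
    (hf : ContMDiffAt 𝓘(ℝ, E) 𝓘(ℝ, ℝ) ∞ f y) :
    ContDiffAt ℝ ∞ (f ∘ (extChartAt 𝓘(ℝ, E) p).symm) (extChartAt 𝓘(ℝ, E) p y) := by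
  have h1 : ContMDiffAt 𝓘(ℝ, E) 𝓘(ℝ, E) ∞ (extChartAt 𝓘(ℝ, E) p).symm (extChartAt 𝓘(ℝ, E) p y) :=
    (contMDiffOn_extChartAt_symm p).contMDiffAt
      ((isOpen_extChartAt_target p).mem_nhds ((extChartAt 𝓘(ℝ, E) p).map_source hy))
  refine ContMDiffAt.contDiffAt ?_
  refine ContMDiffAt.comp _ ?_ h1
  rwa [(extChartAt 𝓘(ℝ, E) p).left_inv hy]

/-- The differential of `F ∘ φ` for the chart `φ` centred at `p`. -/
lemma mvfderiv_comp_extChartAt (hy : y ∈ (extChartAt 𝓘(ℝ, E) p).source) {F : E → ℝ}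
    (hF : DifferentiableAt ℝ F (extChartAt 𝓘(ℝ, E) p y)) :
    mvfderiv 𝓘(ℝ, E) (F ∘ extChartAt 𝓘(ℝ, E) p) y =
      (fderiv ℝ F (extChartAt 𝓘(ℝ, E) p y)).comp (chartDeriv p y) := by
  have h2 : MDifferentiableAt 𝓘(ℝ, E) 𝓘(ℝ, E) (extChartAt 𝓘(ℝ, E) p) y :=
    (contMDiffAt_extChartAt' (n := ∞) (by rwa [← extChartAt_source 𝓘(ℝ, E)])).mdifferentiableAt
      (by simp)
  rw [mvfderiv_comp y hF.mdifferentiableAt h2]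
  ext v
  simp only [mvfderiv, mfderiv_eq_fderiv, chartDeriv]
  rfl

/-- The differential of a function, read in the chart centred at `p`. -/
lemma mvfderiv_eq_fderiv_comp (hy : y ∈ (extChartAt 𝓘(ℝ, E) p).source)
    (hf : MDifferentiableAt 𝓘(ℝ, E) 𝓘(ℝ, ℝ) f y) :
    mvfderiv 𝓘(ℝ, E) f y =
      (fderiv ℝ (f ∘ (extChartAt 𝓘(ℝ, E) p).symm) (extChartAt 𝓘(ℝ, E) p y)).comp
        (chartDeriv p y) := by
  rw [← mvfderiv_comp_extChartAt hy (mdifferentiableAt_comp_symm hy hf)]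
  have h : f =ᶠ[𝓝 y] (f ∘ (extChartAt 𝓘(ℝ, E) p).symm) ∘ extChartAt 𝓘(ℝ, E) p := by
    filter_upwards [(isOpen_extChartAt_source p).mem_nhds hy] with z hz
    simp only [Function.comp_apply, (extChartAt 𝓘(ℝ, E) p).left_inv hz]
  ext v
  simp only [mvfderiv, ContinuousLinearMap.comp_apply, h.mfderiv_eq]
  rfl

omit [IsManifold 𝓘(ℝ, E) ∞ M] in
lemma mvfderiv_congr {f g : M → ℝ} (h : f =ᶠ[𝓝 x] g) :
    mvfderiv 𝓘(ℝ, E) f x = mvfderiv 𝓘(ℝ, E) g x := by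
  ext v
  simp only [mvfderiv, ContinuousLinearMap.comp_apply, h.mfderiv_eq]
  rfl

/-- The vector field `X` read in the chart centred at `p`. -/
def chartField (p : M) (X : VField E M) : E → E := fun u ↦
  chartDeriv p ((extChartAt 𝓘(ℝ, E) p).symm u) (X ((extChartAt 𝓘(ℝ, E) p).symm u))

/-- The derivatives of the chart and of its inverse are mutually inverse. This links `mlieBracket`,
defined by pullback along the inverse chart, to `chartField`. -/
lemma mpullbackWithin_eventuallyEq_chartField (x : M) (X : VField E M) :
    VectorField.mpullbackWithin 𝓘(ℝ, E) 𝓘(ℝ, E) (extChartAt 𝓘(ℝ, E) x).symm X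
      (Set.range 𝓘(ℝ, E)) =ᶠ[𝓝 (extChartAt 𝓘(ℝ, E) x x)] chartField x X := by
  have : IsManifold 𝓘(ℝ, E) 1 M := .of_le (n := ∞) (by simp)
  filter_upwards [(isOpen_extChartAt_target x).mem_nhds (mem_extChartAt_target x)] with u hu
  rw [VectorField.mpullbackWithin_apply]
  rw [ContinuousLinearMap.inverse_eq
    (mfderivWithin_extChartAt_symm_comp_mfderiv_extChartAt hu)
    (mfderiv_extChartAt_comp_mfderivWithin_extChartAt_symm hu)]
  rfl

lemma VFieldDiffAt.differentiableAt_chartField [FiniteDimensional ℝ E] (hX : VFieldDiffAt X x) :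
    DifferentiableAt ℝ (chartField x X) (extChartAt 𝓘(ℝ, E) x x) := by
  have : IsManifold 𝓘(ℝ, E) (minSmoothness ℝ 2) M := .of_le (n := ∞) (by simpa using two_le_infty)
  have h := (mdifferentiableWithinAt_univ.2 hX).differentiableWithinAt_mpullbackWithin_vectorField
  simp only [Set.preimage_univ, Set.univ_inter, modelWithCornersSelf_coe, Set.range_id] at h
  refine (differentiableWithinAt_univ.1 h).congr_of_eventuallyEq ?_
  simpa using (mpullbackWithin_eventuallyEq_chartField x X).symm

lemma chartDeriv_mlieBracket (x : M) (X Y : VField E M) :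
    chartDeriv x x (VectorField.mlieBracket 𝓘(ℝ, E) X Y x) =
      VectorField.lieBracket ℝ (chartField x X) (chartField x Y) (extChartAt 𝓘(ℝ, E) x x) := by
  rw [VectorField.mlieBracket, VectorField.mlieBracketWithin_apply]
  have hx : x ∈ (extChartAt 𝓘(ℝ, E) x).source := mem_extChartAt_source x
  have hi : (chartDeriv (E := E) x x).IsInvertible := isInvertible_chartDeriv hx
  have key (w : E) : chartDeriv x x ((chartDeriv (E := E) x x).inverse w) = w := by
    obtain ⟨e, he⟩ := hi
    rw [← he]
    simp
  have h1 := mpullbackWithin_eventuallyEq_chartField x X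
  have h2 := mpullbackWithin_eventuallyEq_chartField x Y
  have h3 := h1.lieBracket_vectorField_eq (𝕜 := ℝ) h2
  simp only [modelWithCornersSelf_coe, Set.range_id, Set.preimage_univ, Set.univ_inter] at h3 ⊢
  exact (key _).trans ((congrFun VectorField.lieBracketWithin_univ _).trans h3)

/-- `df([X, Y]) = X(Y(f)) - Y(X(f))`. -/
lemma diff_mlieBracket [FiniteDimensional ℝ E] (hf : ContMDiffAt 𝓘(ℝ, E) 𝓘(ℝ, ℝ) ∞ f x)
    (hX : VFieldDiffAt X x) (hY : VFieldDiffAt Y x) :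
    diff f x (VectorField.mlieBracket 𝓘(ℝ, E) X Y x) =
      dirDeriv X (pair (diff f) Y) x - dirDeriv Y (pair (diff f) X) x := by
  set F : E → ℝ := f ∘ (extChartAt 𝓘(ℝ, E) x).symm with hF
  have hx := mem_extChartAt_source (I := 𝓘(ℝ, E)) x
  have hd : ∀ {Z : VField E M}, (pair (diff f) Z) ∘ (extChartAt 𝓘(ℝ, E) x).symm
      =ᶠ[𝓝 (extChartAt 𝓘(ℝ, E) x x)] fun u ↦ fderiv ℝ F u (chartField x Z u) := by
    intro Z
    have hcont : ContinuousAt (extChartAt 𝓘(ℝ, E) x).symm (extChartAt 𝓘(ℝ, E) x x) :=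
      continuousAt_extChartAt_symm x
    have hev : ∀ᶠ y in 𝓝 ((extChartAt 𝓘(ℝ, E) x).symm (extChartAt 𝓘(ℝ, E) x x)),
        ContMDiffAt 𝓘(ℝ, E) 𝓘(ℝ, ℝ) 1 f y := by
      rw [extChartAt_to_inv]
      exact (contMDiffAt_iff_contMDiffAt_nhds (by simp)).1
        (hf.of_le (one_le_two.trans two_le_infty))
    filter_upwards [(isOpen_extChartAt_target x).mem_nhds (mem_extChartAt_target x),
      hcont.eventually hev] with u hu hfu
    simp only [Function.comp_apply, pair, diff]
    rw [mvfderiv_eq_fderiv_comp ((extChartAt 𝓘(ℝ, E) x).map_target hu)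
      (hfu.mdifferentiableAt one_ne_zero), (extChartAt 𝓘(ℝ, E) x).right_inv hu]
    rfl
  have hc : ∀ Z : VField E M, chartField x Z (extChartAt 𝓘(ℝ, E) x x) = chartDeriv x x (Z x) :=
    fun Z ↦ congrArg (fun y ↦ chartDeriv x y (Z y)) (extChartAt_to_inv x)
  have hdir : ∀ {Z Z' : VField E M}, VFieldDiffAt Z' x → dirDeriv Z (pair (diff f) Z') x =
      fderiv ℝ (fun u ↦ fderiv ℝ F u (chartField x Z' u)) (extChartAt 𝓘(ℝ, E) x x)
        (chartField x Z (extChartAt 𝓘(ℝ, E) x x)) := by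
    intro Z Z' hZ'
    rw [dirDeriv, mvfderiv_eq_fderiv_comp hx ((diff_smoothAt hf).diffAt.pair hZ'), hd.fderiv_eq]
    rw [ContinuousLinearMap.comp_apply, ← hc Z]
  -- In the chart this is the flat identity, where the second derivatives of `F` cancel by symmetry.
  rw [hdir hY, hdir hX, ← VectorField.fderiv_apply_lieBracket (n := ∞) (contDiffAt_comp_symm hx hf)
    (by simpa using two_le_infty) hY.differentiableAt_chartField hX.differentiableAt_chartField,
    ← chartDeriv_mlieBracket, diff, mvfderiv_eq_fderiv_comp hx (hf.mdifferentiableAt (by simp))]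
  rfl

end PoissonRiemann
end

noncomputable section

namespace PoissonRiemann
open VectorField (mlieBracket)

variable {E : Type*} [NormedAddCommGroup E] [NormedSpace ℝ E]
  {M : Type*} [TopologicalSpace M] [ChartedSpace E M] [IsManifold 𝓘(ℝ, E) ∞ M]

variable {x : M} {X X' Y : VField E M} {α α' β β' : Form E M} {f h : M → ℝ}

/-! ### Derivations -/

omit [IsManifold 𝓘(ℝ, E) ∞ M] in
lemma diff_add (hf : MDifferentiableAt 𝓘(ℝ, E) 𝓘(ℝ, ℝ) f x)
    (hh : MDifferentiableAt 𝓘(ℝ, E) 𝓘(ℝ, ℝ) h x) :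
    diff (E := E) (f + h) x = diff f x + diff h x := mvfderiv_add hf hh

omit [IsManifold 𝓘(ℝ, E) ∞ M] in
lemma diff_mul (hf : MDifferentiableAt 𝓘(ℝ, E) 𝓘(ℝ, ℝ) f x)
    (hh : MDifferentiableAt 𝓘(ℝ, E) 𝓘(ℝ, ℝ) h x) :
    diff (E := E) (f * h) x = f x • diff h x + h x • diff f x := mvfderiv_mul hf hh

omit [IsManifold 𝓘(ℝ, E) ∞ M] in
lemma diff_neg : diff (E := E) (-f) x = -diff f x := mvfderiv_neg

omit [IsManifold 𝓘(ℝ, E) ∞ M] in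
lemma dirDeriv_eq : dirDeriv X f x = diff f x (X x) := rfl

lemma VFieldDiffAt.add (hX : VFieldDiffAt X x) (hY : VFieldDiffAt Y x) :
    VFieldDiffAt (X + Y) x := mdifferentiableAt_add_section hX hY

lemma VFieldDiffAt.smul (hf : MDifferentiableAt 𝓘(ℝ, E) 𝓘(ℝ, ℝ) f x) (hX : VFieldDiffAt X x) :
    VFieldDiffAt (f • X) x := MDifferentiableAt.smul_section hf hX

lemma FormDiffAt.add (hα : FormDiffAt α x) (hβ : FormDiffAt β x) :
    FormDiffAt (α + β) x := mdifferentiableAt_add_section hα hβ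

lemma FormDiffAt.smul (hf : MDifferentiableAt 𝓘(ℝ, E) 𝓘(ℝ, ℝ) f x) (hα : FormDiffAt α x) :
    FormDiffAt (f • α) x := MDifferentiableAt.smul_section hf hα

variable [FiniteDimensional ℝ E]

omit [FiniteDimensional ℝ E] in
lemma exists_vField (v : TangentSpace 𝓘(ℝ, E) x) : ∃ Y : VField E M, VFieldSmoothAt Y x ∧ Y x = v :=
  ⟨FiberBundle.extend E v, FiberBundle.contMDiffAt_extend 𝓘(ℝ, E) E v,
    FiberBundle.extend_apply_self ..⟩

omit [FiniteDimensional ℝ E] in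
/-- Two covectors at `x` agree if they agree on the values of differentiable vector fields. -/
lemma covector_ext {φ ψ : TangentSpace 𝓘(ℝ, E) x →L[ℝ] ℝ}
    (hφ : ∀ Y : VField E M, VFieldDiffAt Y x → φ (Y x) = ψ (Y x)) : φ = ψ := by
  ext v
  obtain ⟨Y, hY, rfl⟩ := exists_vField v
  exact hφ Y hY.diffAt

lemma covectorOf_apply {Φ : VField E M → ℝ} (hΦ : TensorialAt 𝓘(ℝ, E) E Φ x)
    (hY : VFieldDiffAt Y x) : covectorOf x Φ (Y x) = Φ Y := by
  rw [covectorOf, dif_pos hΦ]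
  exact TensorialAt.mkHom_apply hΦ hY

/-- An operation on vector fields given near `x` by a covector is tensorial. -/
lemma covectorOf_eq {Φ : VField E M → ℝ} {φ : TangentSpace 𝓘(ℝ, E) x →L[ℝ] ℝ}
    (hφ : ∀ Y : VField E M, VFieldDiffAt Y x → Φ Y = φ (Y x)) : covectorOf x Φ = φ := by
  have hΦ : TensorialAt 𝓘(ℝ, E) E Φ x :=
    { smul := fun hf hσ ↦ by
        rw [hφ _ (VFieldDiffAt.smul hf hσ), hφ _ hσ]
        simp
      add := fun hσ hσ' ↦ by
        rw [hφ _ (VFieldDiffAt.add hσ hσ'), hφ _ hσ, hφ _ hσ']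
        simp }
  refine covector_ext fun Y hY ↦ ?_
  rw [covectorOf_apply hΦ hY, hφ Y hY]

/-! ### The Lie derivative of 1-forms -/

/-- `(L_X β)(Y) = X(β(Y)) - β([X, Y])`. -/
lemma lieForm_apply (X : VField E M) (hβ : FormDiffAt β x) (hY : VFieldDiffAt Y x) :
    lieForm X β x (Y x) = dirDeriv X (pair β Y) x - β x (mlieBracket 𝓘(ℝ, E) X Y x) := by
  refine covectorOf_apply (Φ := fun Y ↦
    dirDeriv X (pair β Y) x - β x (mlieBracket 𝓘(ℝ, E) X Y x)) ⟨?_, ?_⟩ hY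
  · intro f Y hf hY
    have h1 : pair β (f • Y) = f * pair β Y := by
      ext y
      simp [pair]
    have h2 := VectorField.mlieBracket_smul_right (V := X) hf hY
    simp only [dirDeriv_eq, h1, diff_mul hf (hβ.pair hY), h2]
    simp [pair, diff]
    ring
  · intro Y Y' hY hY'
    have h1 : pair β (Y + Y') = pair β Y + pair β Y' := by
      ext y
      simp [pair]
    have h2 := VectorField.mlieBracket_add_right (V := X) hY hY'
    simp only [dirDeriv_eq, h1, diff_add (hβ.pair hY) (hβ.pair hY'), h2]
    simp
    ring

lemma lieForm_add_right (X : VField E M) (hα : FormDiffAt α x) (hβ : FormDiffAt β x) :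
    lieForm X (α + β) x = lieForm X α x + lieForm X β x := by
  refine covector_ext fun Y hY ↦ ?_
  have h1 : pair (α + β) Y = pair α Y + pair β Y := rfl
  rw [add_apply, lieForm_apply X hα hY, lieForm_apply X hβ hY,
    lieForm_apply X (hα.add hβ) hY]
  simp only [dirDeriv_eq, h1, diff_add (hα.pair hY) (hβ.pair hY)]
  simp
  ring

lemma lieForm_smul_right (X : VField E M) (hf : MDifferentiableAt 𝓘(ℝ, E) 𝓘(ℝ, ℝ) f x)
    (hβ : FormDiffAt β x) :
    lieForm X (f • β) x = f x • lieForm X β x + dirDeriv X f x • β x := by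
  refine covector_ext fun Y hY ↦ ?_
  have h1 : pair (f • β) Y = f * pair β Y := rfl
  rw [add_apply, smul_apply, lieForm_apply X hβ hY,
    lieForm_apply X (hβ.smul hf) hY]
  simp only [dirDeriv_eq, h1, diff_mul hf (hβ.pair hY)]
  simp [pair]
  ring

lemma lieForm_add_left (hX : VFieldDiffAt X x) (hX' : VFieldDiffAt X' x) (hβ : FormDiffAt β x) :
    lieForm (X + X') β x = lieForm X β x + lieForm X' β x := by
  refine covector_ext fun Y hY ↦ ?_
  rw [add_apply, lieForm_apply X hβ hY, lieForm_apply X' hβ hY,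
    lieForm_apply _ hβ hY, VectorField.mlieBracket_add_left hX hX']
  simp [dirDeriv_eq]
  ring

lemma lieForm_smul_left (hf : MDifferentiableAt 𝓘(ℝ, E) 𝓘(ℝ, ℝ) f x) (hX : VFieldDiffAt X x)
    (hβ : FormDiffAt β x) :
    lieForm (f • X) β x = f x • lieForm X β x + pair β X x • diff f x := by
  refine covector_ext fun Y hY ↦ ?_
  rw [add_apply, smul_apply, lieForm_apply X hβ hY,
    lieForm_apply _ hβ hY, VectorField.mlieBracket_smul_left hf hX]
  simp [dirDeriv_eq, diff, pair]
  ring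

/-! ### The Koszul bracket -/

namespace PoissonTensor
variable (P : PoissonTensor E M)

omit [FiniteDimensional ℝ E] in
lemma eval_diffAt (hα : FormDiffAt α x) (hβ : FormDiffAt β x) :
    MDifferentiableAt 𝓘(ℝ, E) 𝓘(ℝ, ℝ) (P.eval α β) x := hβ.pair (P.sharp_diffAt hα)

omit [FiniteDimensional ℝ E] in
lemma eval_swap : P.eval β α = -P.eval α β := funext fun y ↦ P.skew y (β y) (α y)

omit [FiniteDimensional ℝ E] in
lemma sharp_smul : P.sharp (f • α) = f • P.sharp α := by
  ext y
  simp [sharp]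

omit [FiniteDimensional ℝ E] in
lemma sharp_add : P.sharp (α + β) = P.sharp α + P.sharp β := by
  ext y
  simp [sharp]

lemma koszul_swap : P.koszul β α x = -P.koszul α β x := by
  rw [koszul, koszul, P.eval_swap (α := α) (β := β), diff_neg]
  abel

/-- The term `π(α, β) df` coming from `L_{f π_#(α)} β` cancels the one in `d(f π(α, β))`; only the
derivative of `f` along `π_#(β)` survives. -/
lemma koszul_smul_left (hf : MDifferentiableAt 𝓘(ℝ, E) 𝓘(ℝ, ℝ) f x) (hα : FormDiffAt α x)
    (hβ : FormDiffAt β x) :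
    P.koszul (f • α) β x = f x • P.koszul α β x - dirDeriv (P.sharp β) f x • α x := by
  have h : P.eval (f • α) β = f * P.eval α β := by
    ext y
    simp [eval, pair, sharp]
  rw [koszul, koszul, h, diff_mul hf (P.eval_diffAt hα hβ), sharp_smul,
    lieForm_smul_left hf (P.sharp_diffAt hα) hβ, lieForm_smul_right _ hf hα]
  rw [show pair β (P.sharp α) x = P.eval α β x from rfl]
  module

lemma koszul_smul_right (hf : MDifferentiableAt 𝓘(ℝ, E) 𝓘(ℝ, ℝ) f x) (hα : FormDiffAt α x)
    (hβ : FormDiffAt β x) :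
    P.koszul α (f • β) x = f x • P.koszul α β x + dirDeriv (P.sharp α) f x • β x := by
  rw [P.koszul_swap, P.koszul_smul_left hf hβ hα, P.koszul_swap (α := α)]
  module

lemma koszul_add_left (hα : FormDiffAt α x) (hα' : FormDiffAt α' x) (hβ : FormDiffAt β x) :
    P.koszul (α + α') β x = P.koszul α β x + P.koszul α' β x := by
  have h : P.eval (α + α') β = P.eval α β + P.eval α' β := by
    ext y
    simp [eval, pair, sharp]
  rw [koszul, koszul, koszul, h, diff_add (P.eval_diffAt hα hβ) (P.eval_diffAt hα' hβ), sharp_add,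
    lieForm_add_left (P.sharp_diffAt hα) (P.sharp_diffAt hα') hβ, lieForm_add_right _ hα hα']
  abel

/-- The value of `[α, β]_π` on a vector field. -/
lemma koszul_apply (hα : FormDiffAt α x) (hβ : FormDiffAt β x) (hY : VFieldDiffAt Y x) :
    P.koszul α β x (Y x) =
      dirDeriv (P.sharp α) (pair β Y) x - β x (mlieBracket 𝓘(ℝ, E) (P.sharp α) Y x)
      - (dirDeriv (P.sharp β) (pair α Y) x - α x (mlieBracket 𝓘(ℝ, E) (P.sharp β) Y x))
      - dirDeriv Y (P.eval α β) x := by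
  rw [koszul, sub_apply, sub_apply, lieForm_apply _ hβ hY,
    lieForm_apply _ hα hY, dirDeriv_eq (X := Y)]

end PoissonTensor

end PoissonRiemann
end

/-! ### Closed form, torsion and tensoriality of the metric contravariant connection -/

noncomputable section

namespace PoissonRiemann
open VectorField (mlieBracket)

variable {E : Type*} [NormedAddCommGroup E] [NormedSpace ℝ E]
  {M : Type*} [TopologicalSpace M] [ChartedSpace E M] [IsManifold 𝓘(ℝ, E) ∞ M]
  [FiniteDimensional ℝ E]

variable {x : M} {X X' Y : VField E M} {α α' β β' : Form E M} {f h : M → ℝ}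

namespace Metric
variable (g : Metric E M) (P : PoissonTensor E M)

lemma pair_sharp (α β : Form E M) : pair α (g.sharp β) = g.coInner α β := by
  ext y
  simp [pair, coInner]

lemma coInner_swap (α β : Form E M) : g.coInner β α = g.coInner α β :=
  funext fun _ ↦ g.symm _ _ _

lemma coInner_flat (β : Form E M) (Y : VField E M) : g.coInner β (g.flat Y) = pair β Y := by
  ext y
  simp [pair, coInner]

lemma pair_flat_sharp (β : Form E M) (Y : VField E M) : pair (g.flat Y) (g.sharp β) = pair β Y := by
  rw [pair_sharp, coInner_swap, coInner_flat]

lemma coInner_diffAt (hα : FormDiffAt α x) (hβ : FormDiffAt β x) :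
    MDifferentiableAt 𝓘(ℝ, E) 𝓘(ℝ, ℝ) (g.coInner α β) x := by
  rw [← pair_sharp]
  exact hα.pair (g.sharp_diffAt hβ)

lemma sharp_smul : g.sharp (f • α) = f • g.sharp α := by
  ext y
  simp [sharp]

lemma sharp_add : g.sharp (α + β) = g.sharp α + g.sharp β := by
  ext y
  simp [sharp]

/-- `⟨[γ, α]_π, β⟩` in terms of Lie derivatives, for `γ = g(Y, ·)`. -/
lemma koszul_flat_apply (hα : FormDiffAt α x) (hβ : FormDiffAt β x) (hY : VFieldDiffAt Y x) :
    P.koszul (g.flat Y) α x (g.sharp β x) =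
      diff (g.coInner α β) x (P.sharp (g.flat Y) x)
      - lieForm (g.sharp β) α x (P.sharp (g.flat Y) x)
      - dirDeriv (P.sharp α) (pair β Y) x
      + g.inner x (Y x) (mlieBracket 𝓘(ℝ, E) (P.sharp α) (g.sharp β) x) := by
  -- The terms `-α([π_#(γ), #(β)])` and `-#(β).π(γ, α)` of the bracket combine into `-(L_{#(β)}
  -- α)(π_#(γ))`, leaving one derivative of `Y`.
  rw [P.koszul_apply (g.flat_diffAt hY) hα (g.sharp_diffAt hβ),
    lieForm_apply _ hα (P.sharp_diffAt (g.flat_diffAt hY)), pair_sharp, pair_flat_sharp,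
    VectorField.mlieBracket_swap_apply (V := g.sharp β), PoissonTensor.eval, ← dirDeriv_eq, map_neg]
  simp only [flat]
  ring

/-- Twice the metric contravariant connection, in closed form. -/
def connForm (α β : Form E M) (x : M) : TangentSpace 𝓘(ℝ, E) x →L[ℝ] ℝ :=
  (diff (g.coInner α β) x - lieForm (g.sharp β) α x - lieForm (g.sharp α) β x).comp
      ((P.anchor x).comp (g.inner x))
    + g.inner x (mlieBracket 𝓘(ℝ, E) (P.sharp α) (g.sharp β) x
      + mlieBracket 𝓘(ℝ, E) (P.sharp β) (g.sharp α) x)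
    + P.koszul α β x

lemma contravariantConnection_eq (hα : FormDiffAt α x) (hβ : FormDiffAt β x) :
    g.contravariantConnection P α β x = (1 / 2 : ℝ) • g.connForm P α β x := by
  refine covectorOf_eq fun Y hY ↦ ?_
  have h1 : g.coInner (P.koszul (g.flat Y) α) β x = P.koszul (g.flat Y) α x (g.sharp β x) := by
    rw [← pair_sharp]; rfl
  have h2 : g.coInner (P.koszul (g.flat Y) β) α x = P.koszul (g.flat Y) β x (g.sharp α x) := by
    rw [← pair_sharp]; rfl
  -- The derivatives of `Y` along `π_#(α)` and `π_#(β)` now cancel against the first two terms of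
  -- the Koszul formula, so the expression is tensorial in `Y`.
  simp only [h1, h2, coInner_flat, g.koszul_flat_apply P hα hβ hY,
    g.koszul_flat_apply P hβ hα hY, g.coInner_swap α β, connForm]
  simp only [dirDeriv_eq, pair, add_apply, smul_apply, sub_apply, ContinuousLinearMap.comp_apply,
    map_add, smul_eq_mul, g.symm x (mlieBracket 𝓘(ℝ, E) _ _ x), PoissonTensor.sharp, flat]
  ring

/-- The metric contravariant connection is torsion-free. -/
lemma contravariantConnection_swap (hα : FormDiffAt α x) (hβ : FormDiffAt β x) :
    g.contravariantConnection P α β x = g.contravariantConnection P β α x + P.koszul α β x := by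
  -- The closed form is symmetric in `α` and `β` except for its Koszul term, which is skew.
  rw [contravariantConnection_eq g P hα hβ, contravariantConnection_eq g P hβ hα, connForm,
    connForm, P.koszul_swap (α := α), g.coInner_swap α β, sub_right_comm,
    add_comm (mlieBracket 𝓘(ℝ, E) (P.sharp α) (g.sharp β) x)]
  module

/-- The derivatives of `f` cancel in pairs: two terms `⟨α, β⟩ df`; those along `π_#(β)`, from a Lie
bracket and the Koszul bracket; and those along `#(β)`, by skewness of `π`. -/
lemma connForm_smul_left (hf : MDifferentiableAt 𝓘(ℝ, E) 𝓘(ℝ, ℝ) f x) (hα : FormDiffAt α x)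
    (hβ : FormDiffAt β x) : g.connForm P (f • α) β x = f x • g.connForm P α β x := by
  have h : g.coInner (f • α) β = f * g.coInner α β := by
    ext y
    simp [coInner, sharp_smul]
  ext v
  have hskew := P.skew x (α x) (g.inner x v)
  simp only [connForm, h, diff_mul hf (g.coInner_diffAt hα hβ), g.sharp_smul, P.sharp_smul,
    lieForm_smul_right _ hf hα, lieForm_smul_left hf (g.sharp_diffAt hα) hβ,
    VectorField.mlieBracket_smul_left hf (P.sharp_diffAt hα),
    VectorField.mlieBracket_smul_right hf (g.sharp_diffAt hα), P.koszul_smul_left hf hα hβ]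
  simp only [dirDeriv_eq, pair_sharp, add_apply, smul_apply, sub_apply,
    ContinuousLinearMap.comp_apply, map_add, map_smul, map_neg, neg_smul, neg_apply, smul_eq_mul,
    g.inner_sharp, g.coInner_swap β α, PoissonTensor.sharp, diff, ← g.symm x v] at hskew ⊢
  rw [show g.inner x v (P.anchor x (α x)) = -(α x (P.anchor x (g.inner x v))) from hskew]
  ring

lemma connForm_add_left (hα : FormDiffAt α x) (hα' : FormDiffAt α' x)
    (hβ : FormDiffAt β x) :
    g.connForm P (α + α') β x = g.connForm P α β x + g.connForm P α' β x := by
  have h : g.coInner (α + α') β = g.coInner α β + g.coInner α' β := by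
    ext y
    simp [coInner, sharp_add]
  ext v
  simp only [connForm, h, diff_add (g.coInner_diffAt hα hβ) (g.coInner_diffAt hα' hβ),
    g.sharp_add, P.sharp_add,
    lieForm_add_right _ hα hα', lieForm_add_left (g.sharp_diffAt hα) (g.sharp_diffAt hα') hβ,
    VectorField.mlieBracket_add_left (P.sharp_diffAt hα) (P.sharp_diffAt hα'),
    VectorField.mlieBracket_add_right (g.sharp_diffAt hα) (g.sharp_diffAt hα'),
    P.koszul_add_left hα hα' hβ]
  simp only [add_apply, sub_apply, ContinuousLinearMap.comp_apply, map_add]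
  ring

/-- The value of `D_α β` at `x` depends on `α` only through its value at `x`. -/
lemma contravariantConnection_congr_left (hα : FormDiffAt α x) (hα' : FormDiffAt α' x)
    (hβ : FormDiffAt β x) (h : α x = α' x) :
    g.contravariantConnection P α β x = g.contravariantConnection P α' β x := by
  rw [contravariantConnection_eq g P hα hβ, contravariantConnection_eq g P hα' hβ]
  congr 1
  refine TensorialAt.pointwise (I := 𝓘(ℝ, E)) (F := E →L[ℝ] ℝ)
    (Φ := fun α : Form E M ↦ g.connForm P α β x) ⟨?_, ?_⟩ hα hα' h
  · exact fun hf hα ↦ g.connForm_smul_left P hf hα hβ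
  · exact fun hα hα' ↦ g.connForm_add_left P hα hα' hβ

end Metric

end PoissonRiemann
end

noncomputable section

namespace PoissonRiemann
open VectorField (mlieBracket)

variable {E : Type*} [NormedAddCommGroup E] [NormedSpace ℝ E]
  {M : Type*} [TopologicalSpace M] [ChartedSpace E M] [IsManifold 𝓘(ℝ, E) ∞ M]
  [FiniteDimensional ℝ E]

variable {x : M} {X Y : VField E M} {α β γ : Form E M} {f : M → ℝ} {U : Set M}

/-! ### Global extensions -/

section Extension
variable [T2Space M]

/-- A local extension is cut off by a bump function. Centrality and Poisson fields are tested on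
forms smooth on all of `U`, so germs at `x` would not suffice. -/
lemma exists_global_vField (v : TangentSpace 𝓘(ℝ, E) x) :
    ∃ Y : VField E M, (∀ y, VFieldSmoothAt Y y) ∧ Y x = v := by
  obtain ⟨s, hs, hσ⟩ := FiberBundle.exists_contMDiffOn_extend (k := ∞) 𝓘(ℝ, E) E v
  obtain ⟨ψ, -, hψ⟩ := (SmoothBumpFunction.nhds_basis_tsupport (I := 𝓘(ℝ, E)) x).mem_iff.1
    (interior_mem_nhds.2 hs)
  refine ⟨(ψ : M → ℝ) • FiberBundle.extend E v, ContMDiffOn.smul_section_of_tsupport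
    ψ.contMDiff.contMDiffOn isOpen_interior hψ (hσ.mono interior_subset), ?_⟩
  simp

/-- A smooth function near `x` has the same germ as a smooth function on `M`. -/
lemma exists_global_function {u : Set M} (hu : u ∈ 𝓝 x) (hf : ContMDiffOn 𝓘(ℝ, E) 𝓘(ℝ, ℝ) ∞ f u) :
    ∃ F : M → ℝ, ContMDiff 𝓘(ℝ, E) 𝓘(ℝ, ℝ) ∞ F ∧ F =ᶠ[𝓝 x] f := by
  obtain ⟨ψ, -, hψ⟩ := (SmoothBumpFunction.nhds_basis_tsupport (I := 𝓘(ℝ, E)) x).mem_iff.1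
    (interior_mem_nhds.2 hu)
  refine ⟨fun y ↦ ψ y • f y, contMDiff_of_tsupport fun y hy ↦ ?_, ?_⟩
  · have hy' : y ∈ interior u := hψ (tsupport_smul_subset_left ψ f hy)
    exact ψ.contMDiffAt.smul (hf.contMDiffAt (mem_interior_iff_mem_nhds.1 hy'))
  · filter_upwards [ψ.eventuallyEq_one] with y hy
    simp [hy]

lemma Metric.exists_global_form (g : Metric E M) (φ : TangentSpace 𝓘(ℝ, E) x →L[ℝ] ℝ) :
    ∃ α : Form E M, (∀ y, FormSmoothAt α y) ∧ α x = φ := by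
  obtain ⟨v, rfl⟩ := (g.inner_bijective x).2 φ
  obtain ⟨Y, hY, rfl⟩ := exists_global_vField v
  exact ⟨g.flat Y, fun y ↦ g.flat_smoothAt (hY y), rfl⟩

end Extension

omit [IsManifold 𝓘(ℝ, E) ∞ M] [FiniteDimensional ℝ E] in
lemma mlieBracket_eq_zero_of_eventually_left (hX : ∀ᶠ y in 𝓝 x, X y = 0) (Y : VField E M) :
    mlieBracket 𝓘(ℝ, E) X Y x = 0 := by
  have h : X =ᶠ[𝓝 x] (0 : VField E M) := hX
  exact (h.mlieBracket_vectorField_eq (Filter.EventuallyEq.refl _ Y)).trans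
    (congrFun VectorField.mlieBracket_zero_left x)

/-! ### Casimir functions and central forms -/

namespace PoissonTensor
variable {P : PoissonTensor E M}

/-- By the Leibniz rule `0 = [α, F dF]_π - F [α, dF]_π = π_#(α)(F) dF`. If `π_#(α)` were nonzero at
`x`, a function `F` with nonzero derivative along it would give a contradiction. -/
lemma IsCentralOn.sharp_eq_zero [T2Space M] (hU : IsOpen U) (hα : P.IsCentralOn α U) (hx : x ∈ U) :
    P.sharp α x = 0 := by
  by_contra hv
  have hxs : x ∈ (extChartAt 𝓘(ℝ, E) x).source := mem_extChartAt_source x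
  have hi : (chartDeriv (E := E) x x).IsInvertible := isInvertible_chartDeriv hxs
  have hne : chartDeriv x x (P.sharp α x) ≠ 0 := by
    obtain ⟨e, he⟩ := hi
    rw [← he]
    simpa using hv
  obtain ⟨η, -, hη⟩ := exists_dual_vector ℝ _ (norm_ne_zero_iff.2 hne)
  have hsm : ContMDiffOn 𝓘(ℝ, E) 𝓘(ℝ, ℝ) ∞ (η ∘ extChartAt 𝓘(ℝ, E) x)
      (extChartAt 𝓘(ℝ, E) x).source := by
    rw [extChartAt_source]
    exact η.contDiff.contMDiff.comp_contMDiffOn contMDiffOn_extChartAt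
  obtain ⟨F, hF, hFη⟩ := exists_global_function ((isOpen_extChartAt_source x).mem_nhds hxs) hsm
  have hd : dirDeriv (P.sharp α) F x ≠ 0 := by
    have h := mvfderiv_congr (E := E) hFη
    rw [mvfderiv_comp_extChartAt hxs η.differentiableAt, ContinuousLinearMap.fderiv] at h
    rw [dirDeriv, h, ContinuousLinearMap.comp_apply, hη]
    simpa using hne
  have hdF : ∀ y, FormSmoothAt (E := E) (diff F) y := fun y ↦ diff_smoothAt (hF y)
  have hFd : MDifferentiableAt 𝓘(ℝ, E) 𝓘(ℝ, ℝ) F x := (hF x).mdifferentiableAt (by simp)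
  have h1 := hα.2 (diff F) (smoothForm_of_forall fun y _ ↦ hdF y) x hx
  have h2 := hα.2 (F • diff F) (smoothForm_of_forall fun y _ ↦
    ContMDiffAt.smul_section (hF y) (hdF y)) x hx
  rw [P.koszul_smul_right hFd (hα.1.smoothAt (hU.mem_nhds hx)).diffAt (hdF x).diffAt, h1,
    smul_zero, zero_add, smul_eq_zero_iff_right hd] at h2
  exact hd (by rw [dirDeriv_eq, h2]; rfl)

/-- As `π_#(df)` vanishes on a neighbourhood, only `-L_{π_#(β)} df = -d(π(β, df))` is left of the
bracket, and `π(β, df)` vanishes there too. -/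
lemma IsCasimirOn.isCentralOn (hU : IsOpen U) (hf : P.IsCasimirOn f U) :
    P.IsCentralOn (diff f) U := by
  have hsm : ∀ x ∈ U, ContMDiffAt 𝓘(ℝ, E) 𝓘(ℝ, ℝ) ∞ f x := fun x hx ↦
    hf.1.contMDiffAt (hU.mem_nhds hx)
  refine ⟨smoothForm_of_forall fun x hx ↦ diff_smoothAt (hsm x hx), fun β hβ x hx ↦ ?_⟩
  have hd := (diff_smoothAt (hsm x hx)).diffAt
  have hb := (hβ.smoothAt (hU.mem_nhds hx)).diffAt
  have h0 : ∀ᶠ y in 𝓝 x, P.sharp (diff f) y = 0 := by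
    filter_upwards [hU.mem_nhds hx] with y hy using hf.2 y hy
  have he : P.eval (diff f) β =ᶠ[𝓝 x] 0 := by
    filter_upwards [h0] with y hy
    rw [eval, pair, hy]
    exact map_zero _
  have he' : P.eval β (diff f) =ᶠ[𝓝 x] 0 := by
    rw [P.eval_swap]
    filter_upwards [he] with y hy
    simp [hy]
  refine covector_ext fun Y hY ↦ ?_
  have hm := diff_mlieBracket (hsm x hx) (P.sharp_diffAt hb) hY
  rw [P.koszul_apply hd hb hY, mlieBracket_eq_zero_of_eventually_left h0, hm]
  have hz : ∀ {u : M → ℝ}, u =ᶠ[𝓝 x] 0 → ∀ Z : VField E M, dirDeriv Z u x = 0 := fun hu Z ↦ by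
    rw [dirDeriv, mvfderiv_congr hu, mvfderiv_zero]; rfl
  rw [hz he, show pair (diff f) (P.sharp β) = P.eval β (diff f) from rfl, hz he']
  rw [dirDeriv_eq, h0.self_of_nhds]
  simp only [map_zero, zero_apply, sub_self, sub_zero]

end PoissonTensor

/-! ### Parallel central forms and Poisson vector fields -/

namespace Metric
variable {P : PoissonTensor E M} (g : Metric E M)

/-- For a central form `α` and `X = #(α)`,
`2 ⟨D_β α, γ⟩ = -(L_X β)(π_#(γ)) + γ([π_#(β), X])`. -/
lemma connForm_of_isCentralOn [T2Space M] (hU : IsOpen U) (hα : P.IsCentralOn α U)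
    (hβ : SmoothForm β U) (hγ : SmoothForm γ U) (hx : x ∈ U) :
    g.connForm P β α x (g.sharp γ x) =
      -(lieForm (g.sharp α) β x (P.sharp γ x))
        + γ x (mlieBracket 𝓘(ℝ, E) (P.sharp β) (g.sharp α) x) := by
  have hUx := hU.mem_nhds hx
  have hαx := (hα.1.smoothAt hUx).diffAt
  have hβx := (hβ.smoothAt hUx).diffAt
  have hγx := (hγ.smoothAt hUx).diffAt
  have h0 : ∀ᶠ y in 𝓝 x, P.sharp α y = 0 := by
    filter_upwards [hUx] with y hy using hα.sharp_eq_zero hU hy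
  have hbr : mlieBracket 𝓘(ℝ, E) (P.sharp α) (g.sharp β) x = 0 :=
    mlieBracket_eq_zero_of_eventually_left h0 _
  -- Centrality is also used against `γ`: `[γ, α]_π = 0` says that `d⟨α, β⟩ - L_{#(β)} α` vanishes
  -- on `π_#(γ)`.
  have hk := g.koszul_flat_apply P hαx hβx (g.sharp_diffAt hγx)
  rw [flat_sharp, P.koszul_swap, hα.2 γ hγ x hx, hbr, dirDeriv_eq, h0.self_of_nhds] at hk
  have hk2 : P.koszul β α x = 0 := by rw [P.koszul_swap, hα.2 β hβ x hx, neg_zero]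
  rw [connForm, hk2, hbr, g.coInner_swap α β]
  simp only [neg_zero, map_zero, zero_apply, add_zero, sub_zero] at hk ⊢
  simp only [add_apply, sub_apply, ContinuousLinearMap.comp_apply, inner_sharp]
  rw [g.symm x _ (g.sharp γ x), inner_sharp]
  simp only [PoissonTensor.sharp] at hk ⊢
  linear_combination -hk

/-- For a central form `α`, `2 ⟨D_β α, γ⟩ = -(L_{#(α)} π)(β, γ)`. -/
lemma connForm_eq_neg_lieDeriv [T2Space M] (hU : IsOpen U) (hα : P.IsCentralOn α U)
    (hβ : SmoothForm β U) (hγ : SmoothForm γ U) (hx : x ∈ U) :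
    g.connForm P β α x (g.sharp γ x) = -P.lieDeriv (g.sharp α) β γ x := by
  have hUx := hU.mem_nhds hx
  rw [g.connForm_of_isCentralOn hU hα hβ hγ hx, PoissonTensor.lieDeriv]
  have h1 := lieForm_apply (g.sharp α) (hγ.smoothAt hUx).diffAt
    (P.sharp_diffAt (hβ.smoothAt hUx).diffAt)
  have h2 := P.skew x (lieForm (g.sharp α) β x) (γ x)
  rw [VectorField.mlieBracket_swap_apply, map_neg] at h1
  change _ = -(dirDeriv (g.sharp α) (pair γ (P.sharp β)) x
    - γ x (P.anchor x (lieForm (g.sharp α) β x)) - lieForm (g.sharp α) γ x (P.sharp β x))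
  rw [h1, h2, PoissonTensor.sharp]
  ring

/-- `Dα` and `L_{#(α)} π` differ by the factor `-1/2`, and global forms `γ` realise every covector
at a point. -/
lemma isParallelOn_iff_isPoissonFieldOn [T2Space M] (hU : IsOpen U) (hα : P.IsCentralOn α U) :
    g.IsParallelOn P α U ↔ P.IsPoissonFieldOn (g.sharp α) U := by
  refine ⟨fun h β γ hβ hγ x hx ↦ ?_, fun h β hβ x hx ↦ ?_⟩
  · have hβx := (hβ.smoothAt (hU.mem_nhds hx)).diffAt
    have h1 := h β hβ x hx
    rw [g.contravariantConnection_eq P hβx (hα.1.smoothAt (hU.mem_nhds hx)).diffAt,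
      smul_eq_zero_iff_right (by norm_num)] at h1
    rw [← neg_eq_zero, ← g.connForm_eq_neg_lieDeriv hU hα hβ hγ hx, h1]
    rfl
  · have hβx := (hβ.smoothAt (hU.mem_nhds hx)).diffAt
    rw [g.contravariantConnection_eq P hβx (hα.1.smoothAt (hU.mem_nhds hx)).diffAt,
      smul_eq_zero_iff_right (by norm_num)]
    ext v
    obtain ⟨Y, hY, rfl⟩ := exists_global_vField v
    have hγ : ∀ y, FormSmoothAt (g.flat Y) y := fun y ↦ g.flat_smoothAt (hY y)
    have hγU : SmoothForm (g.flat Y) U := smoothForm_of_forall fun y _ ↦ hγ y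
    have h1 := g.connForm_eq_neg_lieDeriv hU hα hβ hγU hx
    rw [h β _ hβ hγU x hx, sharp_flat, neg_zero] at h1
    exact h1

end Metric

end PoissonRiemann
end

noncomputable section

namespace PoissonRiemann
open VectorField (mlieBracket)
open Module (finrank)

variable {E : Type*} [NormedAddCommGroup E] [NormedSpace ℝ E]
  {M : Type*} [TopologicalSpace M] [ChartedSpace E M] [IsManifold 𝓘(ℝ, E) ∞ M]

/-! ### The Poisson tensor in a chart -/

lemma contDiffOn_of_forall_dual {G F : Type*} [NormedAddCommGroup G] [NormedSpace ℝ G]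
    [NormedAddCommGroup F] [NormedSpace ℝ F] [FiniteDimensional ℝ F] {s : Set G} {f : G → F}
    (h : ∀ ξ : F →L[ℝ] ℝ, ContDiffOn ℝ ∞ (fun u ↦ ξ (f u)) s) : ContDiffOn ℝ ∞ f s := by
  let e : F ≃L[ℝ] (Fin (finrank ℝ F) → ℝ) := ContinuousLinearEquiv.ofFinrankEq (by simp)
  rw [← e.comp_contDiffOn_iff]
  exact contDiffOn_pi.2 fun i ↦ h ((ContinuousLinearMap.proj (R := ℝ)
    (φ := fun _ : Fin (finrank ℝ F) ↦ ℝ) i).comp (e : F →L[ℝ] (Fin (finrank ℝ F) → ℝ)))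

namespace PoissonTensor
variable (P : PoissonTensor E M)

/-- The anchor of the Poisson tensor, read in the chart centred at `p`. -/
def chartAnchor (p : M) (u : E) : (E →L[ℝ] ℝ) →L[ℝ] E :=
  ((chartDeriv p ((extChartAt 𝓘(ℝ, E) p).symm u)).comp
    (P.anchor ((extChartAt 𝓘(ℝ, E) p).symm u))).comp
    (ContinuousLinearMap.precomp ℝ (chartDeriv p ((extChartAt 𝓘(ℝ, E) p).symm u)))

variable {p y x : M} {u : E} {f h : M → ℝ}

lemma chartAnchor_extChartAt_apply (hy : y ∈ (extChartAt 𝓘(ℝ, E) p).source) (η : E →L[ℝ] ℝ) :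
    P.chartAnchor p (extChartAt 𝓘(ℝ, E) p y) η =
      chartDeriv p y (P.anchor y (η.comp (chartDeriv p y))) := by
  exact congrArg (fun z ↦ chartDeriv p z (P.anchor z (η.comp (chartDeriv p z))))
    ((extChartAt 𝓘(ℝ, E) p).left_inv hy)

lemma chartAnchor_skew (p : M) (u : E) (φ η : E →L[ℝ] ℝ) :
    η (P.chartAnchor p u φ) = -φ (P.chartAnchor p u η) :=
  P.skew _ (φ.comp (chartDeriv p _)) (η.comp (chartDeriv p _))

/-- The Poisson bracket of functions, read in a chart. -/
lemma diff_anchor_diff (hy : y ∈ (extChartAt 𝓘(ℝ, E) p).source) {F G : E → ℝ}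
    (hF : DifferentiableAt ℝ F (extChartAt 𝓘(ℝ, E) p y))
    (hG : DifferentiableAt ℝ G (extChartAt 𝓘(ℝ, E) p y))
    (hf : f =ᶠ[𝓝 y] F ∘ extChartAt 𝓘(ℝ, E) p) (hh : h =ᶠ[𝓝 y] G ∘ extChartAt 𝓘(ℝ, E) p) :
    diff h y (P.anchor y (diff f y)) =
      fderiv ℝ G (extChartAt 𝓘(ℝ, E) p y) (P.chartAnchor p (extChartAt 𝓘(ℝ, E) p y)
        (fderiv ℝ F (extChartAt 𝓘(ℝ, E) p y))) := by
  rw [P.chartAnchor_extChartAt_apply hy, diff, diff, mvfderiv_congr hf, mvfderiv_congr hh,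
    mvfderiv_comp_extChartAt hy hF, mvfderiv_comp_extChartAt hy hG]
  rfl

lemma contMDiffOn_comp_extChartAt (p : M) (η : E →L[ℝ] ℝ) :
    ContMDiffOn 𝓘(ℝ, E) 𝓘(ℝ, ℝ) ∞ (η ∘ extChartAt 𝓘(ℝ, E) p)
      (extChartAt 𝓘(ℝ, E) p).source := by
  rw [extChartAt_source]
  exact η.contDiff.contMDiff.comp_contMDiffOn contMDiffOn_extChartAt

variable [FiniteDimensional ℝ E]

/-- The matrix entries `ξ (A u η)` are the Poisson brackets of the functions `η` and `ξ` read
through the chart. -/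
lemma contDiffOn_chartAnchor (p : M) :
    ContDiffOn ℝ ∞ (P.chartAnchor p) (extChartAt 𝓘(ℝ, E) p).target := by
  refine contDiffOn_clm_apply.2 fun η ↦ contDiffOn_of_forall_dual fun ξ ↦ ?_
  intro u hu
  have hy := (extChartAt 𝓘(ℝ, E) p).map_target hu
  have hs (κ : E →L[ℝ] ℝ) := (contMDiffOn_comp_extChartAt p κ).contMDiffAt
    ((isOpen_extChartAt_source p).mem_nhds hy)
  have h := contDiffAt_comp_symm hy
    ((diff_smoothAt (hs ξ)).pair (P.sharp_smoothAt (diff_smoothAt (hs η))))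
  rw [(extChartAt 𝓘(ℝ, E) p).right_inv hu] at h
  refine ContDiffAt.contDiffWithinAt (h.congr_of_eventuallyEq ?_)
  filter_upwards [(isOpen_extChartAt_target p).mem_nhds hu] with v hv
  have := P.diff_anchor_diff ((extChartAt 𝓘(ℝ, E) p).map_target hv) η.differentiableAt
    ξ.differentiableAt (Filter.EventuallyEq.refl _ _) (Filter.EventuallyEq.refl _ _)
  rw [(extChartAt 𝓘(ℝ, E) p).right_inv hv] at this
  simp only [ContinuousLinearMap.fderiv] at this
  exact this.symm

-- This is the Jacobi identity for functions linear in the chart, extended to `M` from their germs.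
-- Their differentials are constant, so only the derivative of the anchor appears.
set_option synthInstance.maxHeartbeats 200000 in
lemma chartAnchor_jacobi [T2Space M] (hu : u ∈ (extChartAt 𝓘(ℝ, E) p).target)
    (φ η κ : E →L[ℝ] ℝ) :
    κ (fderiv ℝ (P.chartAnchor p) u (P.chartAnchor p u φ) η)
      + φ (fderiv ℝ (P.chartAnchor p) u (P.chartAnchor p u η) κ)
      + η (fderiv ℝ (P.chartAnchor p) u (P.chartAnchor p u κ) φ) = 0 := by
  obtain ⟨y, hy, rfl⟩ : ∃ y ∈ (extChartAt 𝓘(ℝ, E) p).source, extChartAt 𝓘(ℝ, E) p y = u :=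
    ⟨_, (extChartAt 𝓘(ℝ, E) p).map_target hu, (extChartAt 𝓘(ℝ, E) p).right_inv hu⟩
  have hext (ξ : E →L[ℝ] ℝ) := exists_global_function
    ((isOpen_extChartAt_source p).mem_nhds hy) (contMDiffOn_comp_extChartAt p ξ)
  have hA : DifferentiableAt ℝ (P.chartAnchor p) (extChartAt 𝓘(ℝ, E) p y) :=
    ((P.contDiffOn_chartAnchor p).contDiffAt
      ((isOpen_extChartAt_target p).mem_nhds hu)).differentiableAt (by simp)
  have key : ∀ (φ η κ : E →L[ℝ] ℝ) (f h k : M → ℝ),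
      f =ᶠ[𝓝 y] φ ∘ extChartAt 𝓘(ℝ, E) p → h =ᶠ[𝓝 y] η ∘ extChartAt 𝓘(ℝ, E) p →
      k =ᶠ[𝓝 y] κ ∘ extChartAt 𝓘(ℝ, E) p →
      diff (fun z ↦ diff k z (P.anchor z (diff h z))) y (P.anchor y (diff f y)) =
        κ (fderiv ℝ (P.chartAnchor p) (extChartAt 𝓘(ℝ, E) p y)
          (P.chartAnchor p (extChartAt 𝓘(ℝ, E) p y) φ) η) := by
    intro φ η κ f h k hf hh hk
    have hG : HasFDerivAt (fun u ↦ κ (P.chartAnchor p u η)) ((κ.comp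
        (ContinuousLinearMap.apply ℝ E η)).comp
          (fderiv ℝ (P.chartAnchor p) (extChartAt 𝓘(ℝ, E) p y))) (extChartAt 𝓘(ℝ, E) p y) :=
      HasFDerivAt.comp (g := κ.comp (ContinuousLinearMap.apply ℝ E η)) _
        (ContinuousLinearMap.hasFDerivAt _) hA.hasFDerivAt
    have hbr : (fun z ↦ diff k z (P.anchor z (diff h z))) =ᶠ[𝓝 y]
        (fun u ↦ κ (P.chartAnchor p u η)) ∘ extChartAt 𝓘(ℝ, E) p := by
      filter_upwards [hh.eventuallyEq_nhds, hk.eventuallyEq_nhds,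
        (isOpen_extChartAt_source p).mem_nhds hy] with z hhz hkz hz
      rw [P.diff_anchor_diff hz η.differentiableAt κ.differentiableAt hhz hkz]
      simp
    rw [P.diff_anchor_diff hy φ.differentiableAt hG.differentiableAt hf hbr, hG.fderiv]
    simp
  obtain ⟨f, hf, hfφ⟩ := hext φ
  obtain ⟨h, hh, hhη⟩ := hext η
  obtain ⟨k, hk, hkκ⟩ := hext κ
  have := P.jacobi f h k hf hh hk y
  simp only at this
  rwa [key φ η κ f h k hfφ hhη hkκ, key η κ φ h k f hhη hkκ hfφ,
    key κ φ η k f h hkκ hfφ hhη] at this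

omit [FiniteDimensional ℝ E] in
lemma rank_chartAnchor (hy : y ∈ (extChartAt 𝓘(ℝ, E) p).source) :
    (P.chartAnchor p (extChartAt 𝓘(ℝ, E) p y)).rank = (P.anchor y).rank := by
  obtain ⟨e, he⟩ := isInvertible_chartDeriv hy
  have h1 : (P.chartAnchor p (extChartAt 𝓘(ℝ, E) p y)).toLinearMap =
      (chartDeriv p y).toLinearMap ∘ₗ (P.anchor y).toLinearMap ∘ₗ
        (ContinuousLinearMap.precomp ℝ (chartDeriv p y)).toLinearMap :=
    LinearMap.ext fun η ↦ P.chartAnchor_extChartAt_apply hy η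
  have h2 : (P.anchor y).toLinearMap = (e.symm : E →L[ℝ] TangentSpace 𝓘(ℝ, E) y).toLinearMap ∘ₗ
      (P.chartAnchor p (extChartAt 𝓘(ℝ, E) p y)).toLinearMap ∘ₗ (ContinuousLinearMap.precomp ℝ
        (e.symm : E →L[ℝ] TangentSpace 𝓘(ℝ, E) y)).toLinearMap := by
    rw [h1, ← he]
    ext φ
    simp [ContinuousLinearMap.comp_assoc]
  refine le_antisymm ?_ ?_
  · change LinearMap.rank (P.chartAnchor p (extChartAt 𝓘(ℝ, E) p y)).toLinearMap ≤ _
    rw [h1]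
    exact (LinearMap.rank_comp_le_right _ _).trans (LinearMap.rank_comp_le_left _ _)
  · change LinearMap.rank (P.anchor y).toLinearMap ≤ _
    rw [h2]
    exact (LinearMap.rank_comp_le_right _ _).trans (LinearMap.rank_comp_le_left _ _)

/-- The rank of a Poisson tensor is lower semicontinuous. -/
lemma eventually_le_rank (x : M) {n : ℕ} (hn : n ≤ (P.anchor x).rank) :
    ∀ᶠ y in 𝓝 x, n ≤ (P.anchor y).rank := by
  have hx : x ∈ (extChartAt 𝓘(ℝ, E) x).source := mem_extChartAt_source x
  have hA : ContinuousAt (P.chartAnchor x) (extChartAt 𝓘(ℝ, E) x x) :=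
    ((P.contDiffOn_chartAnchor x).contDiffAt
      ((isOpen_extChartAt_target x).mem_nhds (mem_extChartAt_target x))).continuousAt
  have hA' : ContinuousAt (fun y ↦ P.chartAnchor x (extChartAt 𝓘(ℝ, E) x y)) x :=
    ContinuousAt.comp (g := P.chartAnchor x) hA (continuousAt_extChartAt x)
  rw [← P.rank_chartAnchor hx] at hn
  filter_upwards [hA'.eventually ((isOpen_setOfPred_nat_le_rank n).mem_nhds hn),
    (isOpen_extChartAt_source x).mem_nhds hx] with y hy hys
  rw [← P.rank_chartAnchor hys]
  exact hy

lemma rank_anchor (x : M) :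
    (P.anchor x).rank = finrank ℝ (LinearMap.range (P.anchor x).toLinearMap) := by
  have : FiniteDimensional ℝ (TangentSpace 𝓘(ℝ, E) x) := inferInstanceAs (FiniteDimensional ℝ E)
  exact (Module.finrank_eq_rank ..).symm

/-- A Poisson tensor is regular on a dense set. -/
lemma dense_regularSet : Dense P.regularSet := by
  refine dense_iff_inter_open.2 fun O hO hne ↦ ?_
  let r : M → ℕ := fun x ↦ finrank ℝ (LinearMap.range (P.anchor x).toLinearMap)
  have hb : BddAbove (r '' O) := by
    refine ⟨finrank ℝ E, ?_⟩
    rintro _ ⟨y, -, rfl⟩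
    have : FiniteDimensional ℝ (TangentSpace 𝓘(ℝ, E) y) := inferInstanceAs (FiniteDimensional ℝ E)
    exact Submodule.finrank_le (LinearMap.range (P.anchor y).toLinearMap)
  -- A point of maximal rank in `O` is regular: nearby the rank cannot drop, by semicontinuity, nor
  -- exceed the maximum.
  obtain ⟨x, hx, hr⟩ := Nat.sSup_mem (hne.image r) hb
  refine ⟨x, hx, ?_⟩
  filter_upwards [P.eventually_le_rank x (P.rank_anchor x).ge, hO.mem_nhds hx] with y hy hyO
  have h1 : r y ≤ r x := hr ▸ le_csSup hb ⟨y, hyO, rfl⟩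
  rw [P.rank_anchor] at hy ⊢
  rw [P.rank_anchor]
  exact_mod_cast le_antisymm h1 (by exact_mod_cast hy)

end PoissonTensor

lemma VFieldSmoothAt.mlieBracket [FiniteDimensional ℝ E] {X Y : VField E M} {x : M}
    (hX : VFieldSmoothAt X x) (hY : VFieldSmoothAt Y x) :
    VFieldSmoothAt (mlieBracket 𝓘(ℝ, E) X Y) x := by
  have : IsManifold 𝓘(ℝ, E) (((⊤ : ℕ∞) : WithTop ℕ∞) + 1) M := ‹IsManifold 𝓘(ℝ, E) ∞ M›
  have : IsManifold 𝓘(ℝ, E) (minSmoothness ℝ 2) M :=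
    .of_le (n := ∞) (by simpa using two_le_infty)
  exact ContMDiffAt.mlieBracket_vectorField (m := ⊤) (n := ⊤) hX hY (by simp)

/-! ### Central forms are parallel: regular points, then density -/

namespace Metric
variable [FiniteDimensional ℝ E] [T2Space M] (g : Metric E M) {P : PoissonTensor E M}
  {α β γ : Form E M} {U : Set M} {x : M}

lemma contravariantConnection_eq_zero_of_mem_regularSet
    (hD : P.IsFRegConnection (g.contravariantConnection P)) (hU : IsOpen U)
    (hα : P.IsCentralOn α U) (hβ : SmoothForm β U) (hx : x ∈ U) (hxr : x ∈ P.regularSet) :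
    g.contravariantConnection P β α x = 0 := by
  have hαx := (hα.1.smoothAt (hU.mem_nhds hx)).diffAt
  have hβx := (hβ.smoothAt (hU.mem_nhds hx)).diffAt
  -- The `F^reg` condition tests forms smooth on the whole regular set, while `α` and `β` are smooth
  -- only on `U`. Each is replaced by a global form while in the tensorial lower slot, `β` before
  -- the torsion swap and `α` after it.
  obtain ⟨α', hα', hαα'⟩ := g.exists_global_form (α x)
  obtain ⟨β', hβ', hββ'⟩ := g.exists_global_form (β x)
  rw [g.contravariantConnection_congr_left P hβx (hβ' x).diffAt hαx hββ'.symm,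
    g.contravariantConnection_swap P (hβ' x).diffAt hαx, P.koszul_swap,
    hα.2 β' (smoothForm_of_forall fun y _ ↦ hβ' y) x hx, neg_zero, add_zero,
    g.contravariantConnection_congr_left P hαx (hα' x).diffAt (hβ' x).diffAt hαα'.symm]
  refine hD α' β' (smoothForm_of_forall fun y _ ↦ hα' y) (smoothForm_of_forall fun y _ ↦ hβ' y)
    x hxr ?_
  rw [PoissonTensor.sharp, hαα']
  exact hα.sharp_eq_zero hU hx

/-- If the metric contravariant connection is an `F^reg`-connection, central forms are parallel. -/
lemma isParallelOn_of_isFRegConnection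
    (hD : P.IsFRegConnection (g.contravariantConnection P)) (hU : IsOpen U)
    (hα : P.IsCentralOn α U) : g.IsParallelOn P α U := by
  intro β hβ x hx
  have hαs {y : M} (hy : y ∈ U) := hα.1.smoothAt (hU.mem_nhds hy)
  have hβs {y : M} (hy : y ∈ U) := hβ.smoothAt (hU.mem_nhds hy)
  rw [g.contravariantConnection_eq P (hβs hx).diffAt (hαs hx).diffAt,
    smul_eq_zero_iff_right (by norm_num)]
  ext v
  obtain ⟨Y, hY, rfl⟩ := exists_global_vField v
  have hγ : ∀ y, FormSmoothAt (g.flat Y) y := fun y ↦ g.flat_smoothAt (hY y)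
  have hV : ∀ y, VFieldSmoothAt (P.sharp (g.flat Y)) y := fun y ↦ P.sharp_smoothAt (hγ y)
  have hX := g.sharp_smoothAt (hαs hx)
  -- `G` is `2⟨D_β α, γ⟩` with the Lie derivative expanded into pairings of smooth sections, so that
  -- its continuity is visible.
  set G : M → ℝ := pair (-diff (pair β (P.sharp (g.flat Y)))) (g.sharp α)
    + pair β (mlieBracket 𝓘(ℝ, E) (g.sharp α) (P.sharp (g.flat Y)))
    + pair (g.flat Y) (mlieBracket 𝓘(ℝ, E) (P.sharp β) (g.sharp α)) with hG
  have hcont : ContinuousAt G x := by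
    have h1 := (diff_smoothAt ((hβs hx).pair (hV x))).pair hX
    have h2 := (hβs hx).pair (hX.mlieBracket (hV x))
    have h3 := (hγ x).pair ((P.sharp_smoothAt (hβs hx)).mlieBracket hX)
    exact (h1.continuousAt.neg.add h2.continuousAt).add h3.continuousAt
  have hGU : ∀ y ∈ U, g.connForm P β α y (Y y) = G y := by
    intro y hy
    have h1 := g.connForm_of_isCentralOn hU hα hβ (smoothForm_of_forall fun y _ ↦ hγ y) hy
    rw [sharp_flat, lieForm_apply _ (hβs hy).diffAt (hV y).diffAt] at h1
    rw [h1]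
    simp [hG, pair, dirDeriv_eq]
    ring
  rw [hGU x hx, zero_apply]
  by_contra hne
  obtain ⟨y, hy, hyr⟩ := P.dense_regularSet.inter_nhds_nonempty
    (Filter.inter_mem (hU.mem_nhds hx) (hcont.eventually_ne hne))
  refine hyr.2 ?_
  have h0 := g.contravariantConnection_eq_zero_of_mem_regularSet hD hU hα hβ hyr.1 hy
  rw [g.contravariantConnection_eq P (hβs hyr.1).diffAt (hαs hyr.1).diffAt,
    smul_eq_zero_iff_right (by norm_num)] at h0
  rw [← hGU y hyr.1, h0]
  rfl

end Metric

end PoissonRiemann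
end

noncomputable section

namespace PoissonRiemann
open Module (finrank)

variable {E : Type*} [NormedAddCommGroup E] [NormedSpace ℝ E] [FiniteDimensional ℝ E]
  {M : Type*} [TopologicalSpace M] [T2Space M] [ChartedSpace E M] [IsManifold 𝓘(ℝ, E) ∞ M]

/-! ### Casimir functions near regular points -/

namespace PoissonTensor
variable (P : PoissonTensor E M) {x : M}

omit [FiniteDimensional ℝ E] [T2Space M] in
lemma isOpen_regularSet : IsOpen P.regularSet := by
  refine isOpen_iff_mem_nhds.2 fun x hx ↦ ?_
  filter_upwards [hx, hx.eventually_nhds] with y hy hy'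
  filter_upwards [hy'] with z hz
  rw [hz, hy]

/-- Near a regular point, every covector in the kernel of the anchor is the differential of a
Casimir function. -/
lemma exists_casimir (hx : x ∈ P.regularSet) {φ : TangentSpace 𝓘(ℝ, E) x →L[ℝ] ℝ}
    (hφ : P.anchor x φ = 0) :
    ∃ (f : M → ℝ) (U : Set M), IsOpen U ∧ x ∈ U ∧ P.IsCasimirOn f U ∧ diff f x = φ := by
  have hxs : x ∈ (extChartAt 𝓘(ℝ, E) x).source := mem_extChartAt_source x
  obtain ⟨e, he⟩ := isInvertible_chartDeriv hxs
  have hr : ∀ᶠ u in 𝓝 (extChartAt 𝓘(ℝ, E) x x),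
      (P.anchor ((extChartAt 𝓘(ℝ, E) x).symm u)).rank = (P.anchor x).rank := by
    have hc : Filter.Tendsto (extChartAt 𝓘(ℝ, E) x).symm (𝓝 (extChartAt 𝓘(ℝ, E) x x)) (𝓝 x) := by
      have := continuousAt_extChartAt_symm (I := 𝓘(ℝ, E)) x
      rwa [ContinuousAt, extChartAt_to_inv] at this
    exact hc.eventually hx
  obtain ⟨W, hW, hWo, hxW⟩ := mem_nhds_iff.1 (Filter.inter_mem hr
    ((isOpen_extChartAt_target x).mem_nhds (mem_extChartAt_target x)))
  -- `θ` is `φ` read in the chart.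
  set θ : E →L[ℝ] ℝ := φ.comp (e.symm : E →L[ℝ] TangentSpace 𝓘(ℝ, E) x) with hθ
  have hθφ : θ.comp (chartDeriv x x) = φ := by
    rw [hθ, ← he]
    ext v
    simp
  have hrank : ∀ u ∈ W, finrank ℝ (LinearMap.range (P.chartAnchor x u).toLinearMap) =
      finrank ℝ (LinearMap.range (P.chartAnchor x (extChartAt 𝓘(ℝ, E) x x)).toLinearMap) := by
    intro u hu
    have h1 := P.rank_chartAnchor ((extChartAt 𝓘(ℝ, E) x).map_target (hW hu).2)
    rw [(extChartAt 𝓘(ℝ, E) x).right_inv (hW hu).2] at h1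
    exact congrArg Cardinal.toNat (h1.trans ((hW hu).1.trans (P.rank_chartAnchor hxs).symm))
  obtain ⟨F, V, hV, hxV, hVW, hF, hdF, hcas⟩ := exists_local_casimir hWo
    ((P.contDiffOn_chartAnchor x).mono fun u hu ↦ (hW hu).2)
    (fun u _ φ η ↦ P.chartAnchor_skew x u φ η)
    (fun u hu φ η κ ↦ P.chartAnchor_jacobi (hW hu).2 φ η κ) hxW hrank (θ := θ)
    (by rw [P.chartAnchor_extChartAt_apply hxs, hθφ, hφ, map_zero])
  have hd : ∀ y ∈ (extChartAt 𝓘(ℝ, E) x).source, extChartAt 𝓘(ℝ, E) x y ∈ V →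
      diff (F ∘ extChartAt 𝓘(ℝ, E) x) y =
        (fderiv ℝ F (extChartAt 𝓘(ℝ, E) x y)).comp (chartDeriv x y) := fun y hy hyV ↦
    mvfderiv_comp_extChartAt hy
      ((hF.contDiffAt (hV.mem_nhds hyV)).differentiableAt (by simp))
  refine ⟨F ∘ extChartAt 𝓘(ℝ, E) x,
    (extChartAt 𝓘(ℝ, E) x).source ∩ extChartAt 𝓘(ℝ, E) x ⁻¹' V,
    (continuousOn_extChartAt x).isOpen_inter_preimage (isOpen_extChartAt_source x) hV,
    ⟨hxs, hxV⟩, ⟨?_, ?_⟩, by rw [hd x hxs hxV, hdF, hθφ]⟩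
  · refine hF.contMDiffOn.comp (ContMDiffOn.mono ?_ Set.inter_subset_left) fun y hy ↦ hy.2
    rw [extChartAt_source]
    exact contMDiffOn_extChartAt
  · rintro y ⟨hy, hyV⟩
    have h1 := hcas _ hyV
    rw [P.chartAnchor_extChartAt_apply hy, ← hd y hy hyV] at h1
    obtain ⟨e', he'⟩ := isInvertible_chartDeriv hy
    rw [← he'] at h1
    exact e'.map_eq_zero_iff.1 h1

end PoissonTensor

/-- If the differentials of Casimir functions are parallel, the metric contravariant connection is
an `F^reg`-connection. -/
lemma Metric.isFRegConnection_of_isParallelOn (g : Metric E M) (P : PoissonTensor E M)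
    (h : ∀ U : Set M, IsOpen U → ∀ f : M → ℝ, P.IsCasimirOn f U → g.IsParallelOn P (diff f) U) :
    P.IsFRegConnection (g.contravariantConnection P) := by
  intro α β hα hβ x hx hαx
  obtain ⟨f, U, hU, hxU, hf, hfα⟩ := P.exists_casimir hx hαx
  have hR := P.isOpen_regularSet.mem_nhds hx
  -- Parallelism is tested against forms smooth on the domain of `f`, and `β` is smooth only on the
  -- regular set; hence the restriction.
  have hUR : IsOpen (U ∩ P.regularSet) := hU.inter P.isOpen_regularSet
  have hf' : P.IsCasimirOn f (U ∩ P.regularSet) :=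
    ⟨hf.1.mono Set.inter_subset_left, fun y hy ↦ hf.2 y hy.1⟩
  have hβ' : SmoothForm β (U ∩ P.regularSet) := ContMDiffOn.mono hβ Set.inter_subset_right
  have hβx := (hβ.smoothAt hR).diffAt
  have hfc := hf'.isCentralOn hUR
  have hfx := (hfc.1.smoothAt (hUR.mem_nhds ⟨hxU, hx⟩)).diffAt
  rw [g.contravariantConnection_congr_left P (hα.smoothAt hR).diffAt hfx hβx hfα.symm,
    g.contravariantConnection_swap P hfx hβx, h _ hUR f hf' β hβ' x ⟨hxU, hx⟩,
    hfc.2 β hβ' x ⟨hxU, hx⟩, add_zero]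

end PoissonRiemann
end

theorem proposition2p4
    {E : Type*} [NormedAddCommGroup E] [NormedSpace ℝ E] [FiniteDimensional ℝ E]
    {M : Type*} [TopologicalSpace M] [T2Space M] [ChartedSpace E M] [IsManifold 𝓘(ℝ, E) ∞ M]
    (g : PoissonRiemann.Metric E M) (P : PoissonRiemann.PoissonTensor E M) :
    List.TFAE
      [∀ U : Set M, IsOpen U → ∀ f : M → ℝ, P.IsCasimirOn f U →
          g.IsParallelOn P (PoissonRiemann.diff f) U,
        ∀ U : Set M, IsOpen U → ∀ α : PoissonRiemann.Form E M, P.IsCentralOn α U →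
          g.IsParallelOn P α U,
        ∀ U : Set M, IsOpen U → ∀ f : M → ℝ, P.IsCasimirOn f U →
          P.IsPoissonFieldOn (g.grad f) U,
        ∀ U : Set M, IsOpen U → ∀ α : PoissonRiemann.Form E M, P.IsCentralOn α U →
          P.IsPoissonFieldOn (g.sharp α) U,
        P.IsFRegConnection (g.contravariantConnection P)] := by
  tfae_have 1 ↔ 3 := forall₂_congr fun _ hU ↦ forall₂_congr fun _ hf ↦
    g.isParallelOn_iff_isPoissonFieldOn hU (hf.isCentralOn hU)
  tfae_have 2 ↔ 4 := forall₂_congr fun _ hU ↦ forall₂_congr fun _ hα ↦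
    g.isParallelOn_iff_isPoissonFieldOn hU hα
  tfae_have 2 → 1 := fun h U hU f hf ↦ h U hU _ (hf.isCentralOn hU)
  tfae_have 1 → 5 := g.isFRegConnection_of_isParallelOn P
  tfae_have 5 → 2 := fun h _ hU _ hα ↦ g.isParallelOn_of_isFRegConnection h hU hα
  tfae_finish
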